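/- Let $p$ be an odd prime, $n \ge 1$, and let $L/K$ be a cyclic Galois extension of degree $p^n$ with group $G = \langle\sigma\rangle$. Assume that $K$ has characteristic $0$ and contains a primitive $p^n$-th root of unity. \textbf{Notation.} A \emph{Hopf--Galois structure} on $L/K$ is a $K$-Hopf algebra $H$ together with an action of $H$ on $L$ making $L$ an $H$-module algebra such that the $K$-linear map $L\otimes_K H\to \mathrm{End}_K(L)$, $x\otimes h\mapsto (y\mapsto x\,h(y))$, is bijective. Two such structures $H_1,H_2$ are isomorphic if there is an isomorphism $\varphi:H_1\to H_2$ of $K$-Hopf algebras with $hx=\varphi(h)x$ for all $h\in H_1$, $x\in L$. Let $N=\langle\eta\rangle$ be a cyclic group of order $p^n$, and let $\delta$ be the $(p-1)$-st power of a generator of $\mathrm{Aut}(N)$. For an integer $s\ge 0$ let $\beta_s:G\to \mathrm{Hol}(N)\subseteq\mathrm{Perm}(N)$ be the homomorphism for which $\beta_s(\sigma)$ is the permutation $\mu\mapsto \delta^s(\mu)\,\eta^{-1}$ of $N$. The map $b_s:G\to N$, $g\mapsto \beta_s(g)(1)$, is a bijection; let $\alpha_s:N\to\mathrm{Perm}(G)$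 be the embedding $\alpha_s(\mu)=b_s^{-1}\circ\lambda(\mu)\circ b_s$, where $\lambda$ denotes left translation. Let $H_s=L[\alpha_s(N)]^G$ be the $K$-algebra of fixed points of the group algebra $L[\alpha_s(N)]$ under the action of $G$ as Galois automorphisms on $L$ and by $g*\pi=\lambda(g)\pi\lambda(g)^{-1}$ on $\alpha_s(N)$. (Since $\delta$ has order $p^{n-1}$, $H_s$ depends only on $s$ modulo $p^{n-1}$; in particular $H_{p^{n-1}}=H_0$.) Let $v_p$ be the $p$-adic valuation, with $v_p(0)=\infty$, and let $\varphi$ be Euler's function. \textbf{Statement.} \begin{enumerate} \item For $0\le r,s<p^{n-1}$, $H_r\cong H_s$ as $K$-algebras if and only if $v_p(r)=v_p(s)$. \item The underlying $K$-algebras of the Hopf--Galois structures on $L/K$ form precisely $n$ isomorphism classes of $K$-algebras. \item For each $0\le v\le n-1$, there are precisely $\varphi(p^{n-1-v})$ isomorphism classes of Hopf--Galois structures on $L/K$ whose underlying $K$-algebra is isomorphic to $H_{p^v}$. \end{enumerate} -/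

import Mathlib

open scoped TensorProduct

universe u v w

/-! ### Hopf-Galois structures on a field extension -/

/-- A Hopf-Galois structure on `L/K`: a `K`-Hopf algebra `H` together with an action of `H` on `L`
that makes `L` an `H`-module algebra and for which the `K`-linear map
`L ⊗ H → End_K(L)`, `x ⊗ h ↦ (y ↦ x * (h y))`, is bijective.
(For a finite extension such an `H` embeds in `End_K(L)`, so taking `H` in the universe
of `L` loses nothing up to isomorphism.) -/
structure HopfGaloisStructure (K : Type u) (L : Type v) [Field K] [Field L] [Algebra K L] where
  /-- The underlying Hopf algebra. -/
  H : Type v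
  [ring : Ring H]
  [hopf : HopfAlgebra K H]
  /-- The action of `H` on `L`. -/
  act : H →ₐ[K] Module.End K L
  /-- `h(1) = ε(h) 1`. -/
  act_one : ∀ h : H, act h 1 = algebraMap K L (Coalgebra.counit (R := K) h)
  /-- `h(x y) = ∑ h₁(x) h₂(y)`, where `Δ(h) = ∑ h₁ ⊗ h₂`. -/
  act_mul : ∀ (h : H) (x y : L),
    act h (x * y) =
      LinearMap.mul' K L
        (TensorProduct.map (act.toLinearMap.flip x) (act.toLinearMap.flip y)
          (Coalgebra.comul (R := K) h))
  bijective : Function.Bijective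
    (TensorProduct.lift
      ((LinearMap.mul K (Module.End K L)).compl₁₂ (Algebra.lmul K L).toLinearMap
        act.toLinearMap) : L ⊗[K] H →ₗ[K] Module.End K L)

attribute [instance] HopfGaloisStructure.ring HopfGaloisStructure.hopf

namespace HopfGaloisStructure

variable (K : Type u) (L : Type v) [Field K] [Field L] [Algebra K L]

/-- Isomorphism of Hopf-Galois structures: there is an isomorphism `φ : H₁ → H₂` of `K`-Hopf
algebras (a bialgebra isomorphism automatically commutes with the antipodes) such that
`h x = φ(h) x` for all `h ∈ H₁` and `x ∈ L`. -/
def isoSetoid : Setoid (HopfGaloisStructure K L) where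
  r S T := ∃ φ : S.H ≃ₐc[K] T.H, ∀ (h : S.H) (x : L), S.act h x = T.act (φ h) x
  iseqv :=
    { refl := fun S => ⟨BialgEquiv.refl K S.H, fun _ _ => rfl⟩
      symm := by
        rintro S T ⟨φ, hφ⟩
        refine ⟨φ.symm, fun h x => ?_⟩
        rw [hφ]
        congr 2
        exact (φ.toEquiv.apply_symm_apply h).symm
      trans := by
        rintro S T U ⟨φ, hφ⟩ ⟨ψ, hψ⟩
        exact ⟨φ.trans ψ, fun h x => (hφ h x).trans (hψ _ x)⟩ }

/-- Two Hopf-Galois structures are related if their underlying `K`-algebras are isomorphic. -/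
def algSetoid : Setoid (HopfGaloisStructure K L) where
  r S T := Nonempty (S.H ≃ₐ[K] T.H)
  iseqv :=
    { refl := fun _ => ⟨AlgEquiv.refl⟩
      symm := fun ⟨e⟩ => ⟨e.symm⟩
      trans := fun ⟨e⟩ ⟨f⟩ => ⟨e.trans f⟩ }

end HopfGaloisStructure

/-! ### The fixed rings `L[M]^G` -/

section FixedRing

variable (K : Type u) (L : Type v) [Field K] [Field L] [Algebra K L]

/-- The left regular embedding `λ : G → Perm(G)`. -/
def leftRegular (G : Type w) [Group G] : G →* Equiv.Perm G := MulAction.toPermHom G G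

/-- The action of `g ∈ G = Gal(L/K)` on the group algebra `L[Perm(G)]`: as a Galois automorphism
on the coefficients and by `π ↦ λ(g) π λ(g)⁻¹` on the group elements. -/
noncomputable def galoisConjAction (g : Gal(L/K)) :
    MonoidAlgebra L (Equiv.Perm Gal(L/K)) →ₐ[K] MonoidAlgebra L (Equiv.Perm Gal(L/K)) :=
  (MonoidAlgebra.mapDomainAlgHom K L
      (MulAut.conj (leftRegular Gal(L/K) g)).toMonoidHom).comp
    (MonoidAlgebra.mapAlgHom (Equiv.Perm Gal(L/K)) g.toAlgHom)

/-- The `K`-algebra `L[M]^G` for a subgroup `M` of `Perm(G)`, `G = Gal(L/K)`: the elements of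
`L[M] ⊆ L[Perm(G)]` that are fixed by every `g ∈ G`. -/
noncomputable def fixedGroupAlgebra (M : Subgroup (Equiv.Perm Gal(L/K))) :
    Subalgebra K (MonoidAlgebra L (Equiv.Perm Gal(L/K))) :=
  (MonoidAlgebra.mapDomainAlgHom K L M.subtype).range ⊓
    ⨅ g : Gal(L/K), AlgHom.equalizer (galoisConjAction K L g) (AlgHom.id K _)

end FixedRing

/-! ### Byott's translation -/

section Byott

variable {G : Type v} {N : Type w} [Group G] [Group N]

/-- For `β : G → Perm(N)` such that `b : g ↦ β(g)(1)` is a bijection `G → N`, the corresponding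
embedding `α : N → Perm(G)`, `α(μ) = b⁻¹ ∘ λ(μ) ∘ b`. -/
noncomputable def byottEmbedding (β : G →* Equiv.Perm N)
    (hβ : Function.Bijective fun g : G => β g 1) : N →* Equiv.Perm G :=
  (Equiv.ofBijective _ hβ).symm.permCongrHom.toMonoidHom.comp (leftRegular N)

/-- The element `(ρ(η), δ)` of `Hol(N) = ρ(N) ⋊ Aut(N)` as a permutation of `N`:
`μ ↦ δ(μ) η⁻¹`, where `ρ(η)(μ) = μ η⁻¹`. -/
def holElement (η : N) (δ : MulAut N) : Equiv.Perm N :=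
  Equiv.mulRight η⁻¹ * MulAut.toPerm N δ

end Byott

/-- The choices that index the Hopf-Galois structures on a cyclic extension of degree `p ^ n`:
`p` is an odd prime, `n ≥ 1`, `G` and `N` are cyclic of order `p ^ n` with generators `σ` and `η`,
and `θ` is a generator of `Aut(N)`. -/
structure CyclicChoice (p n : ℕ) (G : Type v) (N : Type w) [Group G] [Group N] where
  prime : p.Prime
  odd : Odd p
  pos : 0 < n
  card_G : Nat.card G = p ^ n
  card_N : Nat.card N = p ^ n
  σ : G
  σ_gen : ∀ g : G, g ∈ Subgroup.zpowers σ
  η : N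
  η_gen : ∀ μ : N, μ ∈ Subgroup.zpowers η
  θ : MulAut N
  θ_gen : ∀ a : MulAut N, a ∈ Subgroup.zpowers θ

theorem emultiplicity_geom_sum_of_dvd_sub_one {p : ℕ} (hp : p.Prime) (hodd : Odd p) {x : ℤ}
    (hx : (p : ℤ) ∣ x - 1) (m : ℕ) :
    emultiplicity (p : ℤ) (∑ i ∈ Finset.range m, x ^ i) = emultiplicity p m := by
  have hpp : Prime (p : ℤ) := Nat.prime_iff_prime_int.mp hp
  by_cases h1 : x = 1
  · subst h1
    simp [Int.natCast_emultiplicity]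
  have hx' : ¬ (p : ℤ) ∣ x := fun h => by
    have : (p : ℤ) ∣ 1 := by simpa using dvd_sub h hx
    exact hpp.not_dvd_one this
  have h := Int.emultiplicity_pow_sub_pow hp hodd (y := 1) hx hx' m
  rw [one_pow, ← geom_sum_mul, emultiplicity_mul hpp, add_comm] at h
  have hfin : FiniteMultiplicity (p : ℤ) (x - 1) :=
    FiniteMultiplicity.of_prime_left hpp (sub_ne_zero.mpr h1)
  exact WithTop.add_left_cancel (finiteMultiplicity_iff_emultiplicity_ne_top.mp hfin) h

theorem prime_pow_dvd_geom_sum_iff {p : ℕ} (hp : p.Prime) (hodd : Odd p) {x : ℤ}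
    (hx : (p : ℤ) ∣ x - 1) (n m : ℕ) :
    ((p ^ n : ℕ) : ℤ) ∣ ∑ i ∈ Finset.range m, x ^ i ↔ p ^ n ∣ m := by
  rw [Nat.cast_pow, pow_dvd_iff_le_emultiplicity, pow_dvd_iff_le_emultiplicity,
    emultiplicity_geom_sum_of_dvd_sub_one hp hodd hx]

namespace CyclicChoice

variable {p n : ℕ} {G : Type v} {N : Type w} [Group G] [Group N] (D : CyclicChoice p n G N)

/-- `δ` is the `(p - 1)`-st power of the chosen generator of `Aut(N)`. -/
def δ : MulAut N := D.θ ^ (p - 1)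

/-- `π_s = (ρ(η), δ ^ s)`. -/
def π (s : ℕ) : Equiv.Perm N := holElement D.η (D.δ ^ s)

theorem orderOf_η : orderOf D.η = p ^ n := by
  rw [orderOf_eq_card_of_forall_mem_zpowers D.η_gen, D.card_N]

theorem orderOf_σ : orderOf D.σ = p ^ n := by
  rw [orderOf_eq_card_of_forall_mem_zpowers D.σ_gen, D.card_G]

theorem exists_exponent (s : ℕ) :
    ∃ x : ℤ, (p : ℤ) ∣ x - 1 ∧ (D.δ ^ s) D.η = D.η ^ x := by
  obtain ⟨t, ht⟩ := Subgroup.mem_zpowers_iff.mp (D.η_gen (D.θ D.η))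
  have hpow : ∀ k : ℕ, (D.θ ^ k) D.η = D.η ^ (t ^ k) := by
    intro k
    induction k with
    | zero => simp
    | succ k ih =>
      rw [pow_succ, MulAut.mul_apply, ← ht, map_zpow, ih, ← zpow_mul, pow_succ]
  have htp : IsCoprime t (p : ℤ) := by
    rw [isCoprime_comm, Prime.coprime_iff_not_dvd (Nat.prime_iff_prime_int.mp D.prime)]
    rintro ⟨c, rfl⟩
    have h1 : orderOf (D.θ D.η) = p ^ n := by
      rw [MulEquiv.orderOf_eq, D.orderOf_η]
    have h2 : (D.θ D.η) ^ (p ^ (n - 1)) = 1 := by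
      rw [← ht, ← zpow_natCast, ← zpow_mul, ← orderOf_dvd_iff_zpow_eq_one, D.orderOf_η]
      refine ⟨c, ?_⟩
      obtain ⟨k, rfl⟩ := Nat.exists_eq_succ_of_ne_zero D.pos.ne'
      push_cast [Nat.succ_eq_add_one, Nat.add_sub_cancel]
      ring
    have h3 := orderOf_dvd_of_pow_eq_one h2
    rw [h1, Nat.pow_dvd_pow_iff_le_right D.prime.one_lt] at h3
    have := D.pos
    omega
  refine ⟨t ^ ((p - 1) * s), ?_, ?_⟩
  · have hF := Int.ModEq.pow_card_sub_one_eq_one D.prime htp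
    have := (hF.pow s).symm.dvd
    rwa [one_pow, ← pow_mul] at this
  · rw [δ, ← pow_mul, hpow]

theorem π_pow_apply {s : ℕ} {x : ℤ} (hx : (D.δ ^ s) D.η = D.η ^ x) (m : ℕ) (k : ℤ) :
    (D.π s ^ m) (D.η ^ k) = D.η ^ (x ^ m * k - ∑ i ∈ Finset.range m, x ^ i) := by
  induction m with
  | zero => simp
  | succ m ih =>
    rw [pow_succ', Equiv.Perm.mul_apply, ih]
    change (D.δ ^ s) (D.η ^ _) * D.η⁻¹ = _
    rw [map_zpow, hx, ← zpow_mul, ← zpow_neg_one, ← zpow_add, geom_sum_succ]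
    congr 1
    ring

theorem orderOf_π_dvd (s : ℕ) : orderOf (D.π s) ∣ orderOf D.σ := by
  obtain ⟨x, hx1, hx⟩ := D.exists_exponent s
  rw [D.orderOf_σ]
  apply orderOf_dvd_of_pow_eq_one
  ext μ
  obtain ⟨k, rfl⟩ := Subgroup.mem_zpowers_iff.mp (D.η_gen μ)
  rw [D.π_pow_apply hx, Equiv.Perm.one_apply, zpow_eq_zpow_iff_modEq, D.orderOf_η]
  apply Int.ModEq.symm
  rw [Int.modEq_iff_dvd]
  have h := (prime_pow_dvd_geom_sum_iff D.prime D.odd hx1 n (p ^ n)).mpr dvd_rfl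
  have e : x ^ p ^ n * k - ∑ i ∈ Finset.range (p ^ n), x ^ i - k =
      (∑ i ∈ Finset.range (p ^ n), x ^ i) * ((x - 1) * k - 1) := by
    linear_combination (-k) * geom_sum_mul x (p ^ n)
  rw [e]
  exact h.mul_right _

/-- The homomorphism `β_s : G → Hol(N) ⊆ Perm(N)` with `β_s(σ) = (ρ(η), δ ^ s)`. -/
noncomputable def β (s : ℕ) : G →* Equiv.Perm N :=
  monoidHomOfForallMemZpowers D.σ_gen (D.orderOf_π_dvd s)

theorem β_σ (s : ℕ) : D.β s D.σ = D.π s :=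
  monoidHomOfForallMemZpowers_apply_gen D.σ_gen (D.orderOf_π_dvd s)

theorem β_bijective (s : ℕ) : Function.Bijective fun g : G => D.β s g 1 := by
  obtain ⟨x, hx1, hx⟩ := D.exists_exponent s
  have hpos : 0 < p ^ n := pow_pos D.prime.pos n
  have : Finite G := Nat.finite_of_card_ne_zero (by rw [D.card_G]; exact hpos.ne')
  have : Finite N := Nat.finite_of_card_ne_zero (by rw [D.card_N]; exact hpos.ne')
  have hval : ∀ m : ℕ, D.β s (D.σ ^ m) 1 = D.η ^ (-∑ i ∈ Finset.range m, x ^ i) := by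
    intro m
    have := D.π_pow_apply hx m 0
    rwa [zpow_zero, mul_zero, zero_sub, ← D.β_σ, ← map_pow] at this
  have key : ∀ a c : ℕ, D.β s (D.σ ^ a) 1 = D.β s (D.σ ^ (a + c)) 1 →
      D.σ ^ a = D.σ ^ (a + c) := by
    intro a c h
    rw [hval, hval, zpow_eq_zpow_iff_modEq, D.orderOf_η, Int.neg_modEq_neg,
      Int.modEq_iff_dvd] at h
    have e : ∑ i ∈ Finset.range (a + c), x ^ i - ∑ i ∈ Finset.range a, x ^ i =
        x ^ a * ∑ i ∈ Finset.range c, x ^ i := by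
      rw [Finset.sum_range_add, add_sub_cancel_left, Finset.mul_sum]
      simp only [pow_add]
    rw [e] at h
    have hcop : IsCoprime ((p ^ n : ℕ) : ℤ) (x ^ a) := by
      rw [Nat.cast_pow]
      apply IsCoprime.pow
      obtain ⟨c, hc⟩ := hx1
      exact ⟨-c, 1, by linear_combination hc⟩
    have h2 := (prime_pow_dvd_geom_sum_iff D.prime D.odd hx1 n c).mp (hcop.dvd_of_dvd_mul_left h)
    rw [← D.orderOf_σ] at h2
    rw [pow_add, orderOf_dvd_iff_pow_eq_one.mp h2, mul_one]
  have hinj : Function.Injective fun g : G => D.β s g 1 := by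
    intro g g' h
    obtain ⟨a, rfl⟩ := mem_powers_iff_mem_zpowers.mpr (D.σ_gen g)
    obtain ⟨c, rfl⟩ := mem_powers_iff_mem_zpowers.mpr (D.σ_gen g')
    change D.σ ^ a = D.σ ^ c
    replace h : D.β s (D.σ ^ a) 1 = D.β s (D.σ ^ c) 1 := h
    rcases le_total a c with hac | hac
    · obtain ⟨d, rfl⟩ := Nat.exists_eq_add_of_le hac
      exact key _ _ h
    · obtain ⟨d, rfl⟩ := Nat.exists_eq_add_of_le hac
      exact (key _ _ h.symm).symm
  exact (Nat.bijective_iff_injective_and_card _).mpr ⟨hinj, by rw [D.card_G, D.card_N]⟩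

/-- The embedding `α_s : N → Perm(G)` that corresponds to `β_s`. -/
noncomputable def α (s : ℕ) : N →* Equiv.Perm G :=
  byottEmbedding (D.β s) (D.β_bijective s)

end CyclicChoice

/-- `H_s = L[α_s(N)]^G` as a `K`-algebra, for `G = Gal(L/K)`. -/
noncomputable abbrev CyclicChoice.H {K : Type u} {L : Type v} [Field K] [Field L] [Algebra K L]
    {N : Type w} [Group N] {p n : ℕ} (D : CyclicChoice p n Gal(L/K) N) (s : ℕ) :
    Subalgebra K (MonoidAlgebra L (Equiv.Perm Gal(L/K))) :=
  fixedGroupAlgebra K L (D.α s).range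

/-!
Galois descent turns a Hopf-Galois structure `H` on `L/K` into a skew brace. Indeed `L ⊗ H` is
identified with `End_K(L)`, its group-like elements are exactly the automorphisms `g` of `L/K`, and
they form a group `N` under the multiplication of `L ⊗ H`. As `Gal(L/K)` acts on `L ⊗ H` through
`L`, it acts on `N`, and the bijection `e : Gal(L/K) → N` satisfies `e (τ g) = e τ * τ (e g)`.
Conversely, such an `e` makes the fixed ring of `L[N]` under the action of `Gal(L/K)` on both `L`
and `N` a Hopf-Galois structure.

The main point is that `N` is cyclic. On the Frattini quotient `V = 𝔽_p ^ d` of `N`, the generator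
`σ` acts by a unipotent `A`, and the vectors `(1 + A + ⋯ + A ^ (k - 1)) b` with `b` the class of
`e σ` exhaust `V`. But `1 + A + ⋯ + A ^ (q - 1) = (A - 1) ^ (q - 1)` for each power `q` of `p`, and
for `q = p ^ (d - 1)` this vanishes if `d ≥ 2`, because `p` is odd. So there would be at most `q`
such vectors. Hence `e σ` generates `N`, and the structure is determined by the residue
`x ≡ 1 [MOD p]` modulo `p ^ n` for which `σ` maps `e σ` to its `x`-th power. These residues
correspond to the powers `δ ^ s` with `s < p ^ (n - 1)`.

As an algebra, `H_s` is the ring of fixed points of `L[N]` when `σ` acts on `N` as `δ ^ s`. Because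
`K` contains the values of all characters of `N`, the Fourier transform identifies it with the
families in `L` indexed by the characters that are compatible with the permutation of the characters
induced by `δ ^ s`. Two permutations generating the same cyclic group are conjugate, so that the
isomorphism class of this algebra depends only on the subgroup generated by `δ ^ s`; and the order
of `δ ^ s` can be recovered from the action of `Gal(L/K)` on the `K`-algebra maps `H_s → L`.
-/

/-! ### Galois descent -/

section GaloisBasis

variable (K : Type u) (L : Type v) [Field K] [Field L] [Algebra K L]

theorem linearIndependent_algEquiv_toLinearMap :
    LinearIndependent L fun g : Gal(L/K) => (g.toLinearMap : Module.End K L) :=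
  (linearIndependent_toLinearMap K L L).comp (fun g : Gal(L/K) => (g : L →ₐ[K] L))
    fun _ _ h => AlgEquiv.ext fun x => DFunLike.congr_fun h x

variable [FiniteDimensional K L] [IsGalois K L]

/-- The automorphisms of a finite Galois extension `L/K` as an `L`-basis of `End_K(L)`. -/
noncomputable def galoisBasis : Module.Basis Gal(L/K) L (Module.End K L) :=
  basisOfLinearIndependentOfCardEqFinrank (linearIndependent_algEquiv_toLinearMap K L) (by
    rw [Module.finrank_linearMap_self, ← IsGalois.card_aut_eq_finrank, Nat.card_eq_fintype_card])

@[simp] theorem galoisBasis_apply (g : Gal(L/K)) : galoisBasis K L g = g.toLinearMap := by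
  simp [galoisBasis]

open scoped Classical in
theorem exists_sum_mul_galois_eq_ite : ∃ (m : ℕ) (x y : Fin m → L),
    ∀ g : Gal(L/K), ∑ i, x i * g (y i) = if g = 1 then 1 else 0 := by
  let b := Module.finBasis K L
  let e (i) : Module.End K L := Algebra.linearMap K L ∘ₗ b.coord i
  have expand (f : Module.End K L) : ∑ i, f (b i) • e i = f :=
    b.ext fun j => by
      simp [e, LinearMap.sum_apply, Finsupp.single_apply, apply_ite (algebraMap K L)]
  refine ⟨_, fun i => (galoisBasis K L).coord 1 (e i), b, fun g => ?_⟩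
  have hcoord : (galoisBasis K L).coord 1 g.toLinearMap = if g = 1 then 1 else 0 := by
    rw [← galoisBasis_apply, Module.Basis.coord_apply, Module.Basis.repr_self,
      Finsupp.single_apply]
  rw [← hcoord, ← expand g.toLinearMap]
  simp [mul_comm]

end GaloisBasis

/-- A semilinear action of `Gal(L/K)` on an `L`-vector space `W`. -/
structure SemilinearGaloisAction (K : Type u) (L : Type v) [Field K] [Field L] [Algebra K L]
    (W : Type*) [AddCommGroup W] [Module L W] where
  act (g : Gal(L/K)) : W →ₛₗ[(g : L →+* L)] W
  act_one (w : W) : act 1 w = w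
  act_mul (g h : Gal(L/K)) (w : W) : act (g * h) w = act g (act h w)

namespace SemilinearGaloisAction

variable {K : Type u} {L : Type v} [Field K] [Field L] [Algebra K L]
  {V W W' : Type*} [AddCommGroup V] [Module K V]
  [AddCommGroup W] [Module L W] [AddCommGroup W'] [Module L W']

variable (K L V) in
/-- The action of `Gal(L/K)` on the first factor of `L ⊗ V`. -/
noncomputable def baseChange : SemilinearGaloisAction K L (L ⊗[K] V) where
  act g :=
    { g.toLinearMap.rTensor V with
      map_smul' := fun c t => by
        induction t with
        | zero => simp
        | add s t hs ht => simp_all [smul_add]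
        | tmul d v => simp [TensorProduct.smul_tmul'] }
  act_one t := by
    induction t with
    | zero => exact map_zero _
    | add s t hs ht => rw [map_add, hs, ht]
    | tmul c v => rfl
  act_mul g h t := by
    induction t with
    | zero => simp only [map_zero]
    | add s t hs ht => rw [map_add, hs, ht, map_add, map_add]
    | tmul c v => rfl

@[simp] theorem baseChange_act_tmul (g : Gal(L/K)) (c : L) (v : V) :
    (baseChange K L V).act g (c ⊗ₜ v) = g c ⊗ₜ v := rfl

/-- The diagonal action of `Gal(L/K)` on `W ⊗_L W'`. -/
noncomputable def tensor (ρ : SemilinearGaloisAction K L W) (ρ' : SemilinearGaloisAction K L W') :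
    SemilinearGaloisAction K L (W ⊗[L] W') where
  act g := TensorProduct.map (ρ.act g) (ρ'.act g)
  act_one t := by
    induction t with
    | zero => exact map_zero _
    | add s t hs ht => rw [map_add, hs, ht]
    | tmul w w' => rw [TensorProduct.map_tmul, ρ.act_one, ρ'.act_one]
  act_mul g h t := by
    induction t with
    | zero => simp only [map_zero]
    | add s t hs ht => rw [map_add, hs, ht, map_add, map_add]
    | tmul w w' => simp only [TensorProduct.map_tmul, ρ.act_mul, ρ'.act_mul]

@[simp] theorem tensor_act_tmul (ρ : SemilinearGaloisAction K L W)
    (ρ' : SemilinearGaloisAction K L W') (g : Gal(L/K)) (w : W) (w' : W') :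
    (ρ.tensor ρ').act g (w ⊗ₜ w') = ρ.act g w ⊗ₜ ρ'.act g w' := rfl

variable [Module K W] [IsScalarTower K L W] (ρ : SemilinearGaloisAction K L W)

/-- The `K`-subspace of elements of `W` that are fixed by `Gal(L/K)`. -/
def invariants : Submodule K W where
  carrier := {w | ∀ g, ρ.act g w = w}
  zero_mem' g := map_zero _
  add_mem' hv hw g := by rw [map_add, hv g, hw g]
  smul_mem' c w hw g := by
    rw [← algebraMap_smul L c w, map_smulₛₗ, hw g]
    congr 1
    exact g.commutes c

section Trace

variable [FiniteDimensional K L]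

omit [Module K W] [IsScalarTower K L W] in
theorem act_sum_act (h : Gal(L/K)) (w : W) : ρ.act h (∑ g, ρ.act g w) = ∑ g, ρ.act g w := by
  rw [map_sum]
  exact Fintype.sum_equiv (Equiv.mulLeft h) _ _ fun g => (ρ.act_mul h g w).symm

theorem sum_act_mem_invariants (w : W) : ∑ g, ρ.act g w ∈ ρ.invariants :=
  fun h => ρ.act_sum_act h w

omit [Module K W] [IsScalarTower K L W] in
open scoped Classical in
theorem eq_sum_smul_sum_act {m : ℕ} {x y : Fin m → L}
    (hxy : ∀ g : Gal(L/K), ∑ i, x i * g (y i) = if g = 1 then 1 else 0) (w : W) :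
    w = ∑ i, x i • ∑ g, ρ.act g (y i • w) := by
  simp only [map_smulₛₗ, Finset.smul_sum, smul_smul]
  rw [Finset.sum_comm]
  simp only [← Finset.sum_smul]
  refine ((Finset.sum_eq_single 1 (fun g _ hg => ?_) (by simp)).trans ?_).symm
  · exact (congrArg (· • ρ.act g w) ((hxy g).trans (if_neg hg))).trans (zero_smul _ _)
  · exact (congrArg (· • ρ.act 1 w) ((hxy 1).trans (if_pos rfl))).trans
      ((one_smul _ _).trans (ρ.act_one w))

variable [IsGalois K L]

theorem sum_baseChange_act_tmul (c : L) (v : V) :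
    ∑ g, (baseChange K L V).act g (c ⊗ₜ v) = 1 ⊗ₜ (Algebra.trace K L c • v) := by
  simp only [baseChange_act_tmul, ← TensorProduct.sum_tmul]
  rw [← trace_eq_sum_automorphisms, Algebra.algebraMap_eq_smul_one, TensorProduct.smul_tmul]

theorem exists_one_tmul_eq_sum_baseChange_act (t : L ⊗[K] V) :
    ∃ v : V, 1 ⊗ₜ v = ∑ g, (baseChange K L V).act g t := by
  induction t with
  | zero => exact ⟨0, by simp⟩
  | tmul c v => exact ⟨_, (sum_baseChange_act_tmul c v).symm⟩
  | add s t hs ht =>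
    obtain ⟨v, hv⟩ := hs
    obtain ⟨w, hw⟩ := ht
    exact ⟨v + w, by simp only [TensorProduct.tmul_add, hv, hw, map_add, Finset.sum_add_distrib]⟩

theorem exists_one_tmul_eq {t : L ⊗[K] V} (ht : t ∈ (baseChange K L V).invariants) :
    ∃ v : V, 1 ⊗ₜ v = t := by
  obtain ⟨z, hz⟩ := Algebra.trace_surjective K L 1
  obtain ⟨v, hv⟩ := exists_one_tmul_eq_sum_baseChange_act (z • t)
  refine ⟨v, hv.trans ?_⟩
  have hz' : ∑ g : Gal(L/K), g z = 1 := by rw [← trace_eq_sum_automorphisms, hz, map_one]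
  simp only [map_smulₛₗ, ht _, ← Finset.sum_smul]
  exact (congrArg (· • t) hz').trans (one_smul L t)

end Trace

theorem liftBaseChange_act {f : V →ₗ[K] W} (hf : ∀ v, f v ∈ ρ.invariants) (g : Gal(L/K))
    (t : L ⊗[K] V) :
    f.liftBaseChange L ((baseChange K L V).act g t) = ρ.act g (f.liftBaseChange L t) := by
  induction t with
  | zero => simp only [map_zero]
  | add s t hs ht => simp only [map_add, hs, ht]
  | tmul c v =>
    rw [baseChange_act_tmul, LinearMap.liftBaseChange_tmul, LinearMap.liftBaseChange_tmul,
      map_smulₛₗ, hf v g]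
    rfl

variable [FiniteDimensional K L] [IsGalois K L]

theorem bijective_liftBaseChange_invariants :
    Function.Bijective (ρ.invariants.subtype.liftBaseChange L) := by
  classical
  obtain ⟨m, x, y, hxy⟩ := exists_sum_mul_galois_eq_ite K L
  have equivariant := ρ.liftBaseChange_act (f := ρ.invariants.subtype) fun v => v.2
  constructor
  · rw [injective_iff_map_eq_zero]
    intro t ht
    rw [(baseChange K L _).eq_sum_smul_sum_act hxy t]
    refine Finset.sum_eq_zero fun i _ => ?_
    obtain ⟨v, hv⟩ := exists_one_tmul_eq_sum_baseChange_act (y i • t)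
    have hv0 : v = 0 := by
      have := congrArg (ρ.invariants.subtype.liftBaseChange L) hv
      simp only [map_sum, equivariant, map_smul, ht, smul_zero, map_zero, Finset.sum_const_zero,
        LinearMap.liftBaseChange_tmul, one_smul] at this
      exact Subtype.ext this
    rw [← hv, hv0, TensorProduct.tmul_zero, smul_zero]
  · intro w
    refine ⟨∑ i, x i ⊗ₜ ⟨_, ρ.sum_act_mem_invariants (y i • w)⟩, ?_⟩
    simp only [map_sum, LinearMap.liftBaseChange_tmul, Submodule.subtype_apply]
    exact (ρ.eq_sum_smul_sum_act hxy w).symm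

theorem isBaseChange_invariants : IsBaseChange L ρ.invariants.subtype :=
  .of_equiv (.ofBijective _ ρ.bijective_liftBaseChange_invariants) fun w => by simp

variable {ρ} in
theorem exists_eq_of_mem_invariants {f : V →ₗ[K] W} (hf : IsBaseChange L f)
    (hfix : ∀ v, f v ∈ ρ.invariants) {w : W} (hw : w ∈ ρ.invariants) : ∃ v, f v = w := by
  have hequiv (t : L ⊗[K] V) : hf.equiv t = f.liftBaseChange L t := by
    induction t with
    | zero => simp only [map_zero]
    | add s t hs ht => simp only [map_add, hs, ht]
    | tmul c v => rw [hf.equiv_tmul, LinearMap.liftBaseChange_tmul]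
  obtain ⟨t, rfl⟩ := hf.equiv.surjective w
  have ht : t ∈ (baseChange K L V).invariants := fun g => hf.equiv.injective <| by
    rw [hequiv, ρ.liftBaseChange_act hfix, ← hequiv, hw g]
  obtain ⟨v, rfl⟩ := exists_one_tmul_eq ht
  exact ⟨v, by rw [hf.equiv_tmul, one_smul]⟩

end SemilinearGaloisAction

/-! ### Descent of Hopf algebras -/

section DescentMap

variable {K : Type u} {L : Type v} [Field K] [Field L] [Algebra K L]
  {V V' W W' : Type*} [AddCommGroup V] [Module K V] [AddCommGroup V'] [Module K V']
  [AddCommGroup W] [Module K W] [Module L W] [IsScalarTower K L W]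
  [AddCommGroup W'] [Module K W'] [Module L W'] [IsScalarTower K L W']

variable (L) in
/-- The natural map `V ⊗_K V' → W ⊗_L W'` attached to `K`-linear maps `V → W` and `V' → W'`. -/
noncomputable def descentMap (f : V →ₗ[K] W) (g : V' →ₗ[K] W') : V ⊗[K] V' →ₗ[K] W ⊗[L] W' :=
  TensorProduct.mapOfCompatibleSMul L K K W W' ∘ₗ TensorProduct.map f g

@[simp] theorem descentMap_tmul (f : V →ₗ[K] W) (g : V' →ₗ[K] W') (x : V) (y : V') :
    descentMap L f g (x ⊗ₜ y) = f x ⊗ₜ g y := rfl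

theorem isBaseChange_descentMap {f : V →ₗ[K] W} {g : V' →ₗ[K] W'} (hf : IsBaseChange L f)
    (hg : IsBaseChange L g) : IsBaseChange L (descentMap L f g) :=
  .of_equiv (TensorProduct.AlgebraTensorModule.distribBaseChange K L V V' ≪≫ₗ
    TensorProduct.congr hf.equiv hg.equiv) fun t => by
      induction t with
      | zero => simp
      | add s t hs ht => simp only [TensorProduct.tmul_add, map_add, hs, ht]
      | tmul x y => simp [IsBaseChange.equiv_tmul]

theorem injective_of_isBaseChange {f : V →ₗ[K] W} (hf : IsBaseChange L f) :
    Function.Injective f := by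
  have h := hf.equiv.injective.comp
    (Module.FaithfullyFlat.tensorProduct_mk_injective (A := K) (B := L) V)
  intro x y hxy
  exact h (by simpa [IsBaseChange.equiv_tmul] using hxy)

theorem descentMap_rTensor {V₁ W₁ : Type*} [AddCommGroup V₁] [Module K V₁]
    [AddCommGroup W₁] [Module K W₁] [Module L W₁] [IsScalarTower K L W₁]
    {f : V →ₗ[K] W} {f₁ : V₁ →ₗ[K] W₁} {u : V →ₗ[K] V₁} {u' : W →ₗ[L] W₁}
    (hu : ∀ x, f₁ (u x) = u' (f x)) (g : V' →ₗ[K] W') (t : V ⊗[K] V') :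
    descentMap L f₁ g (u.rTensor V' t) = u'.rTensor W' (descentMap L f g t) := by
  induction t with
  | zero => simp only [map_zero]
  | add s t hs ht => simp only [map_add, hs, ht]
  | tmul x y => simp [hu]

theorem descentMap_lTensor {V₁ W₁ : Type*} [AddCommGroup V₁] [Module K V₁]
    [AddCommGroup W₁] [Module K W₁] [Module L W₁] [IsScalarTower K L W₁]
    {g : V' →ₗ[K] W'} {g₁ : V₁ →ₗ[K] W₁} {u : V' →ₗ[K] V₁} {u' : W' →ₗ[L] W₁}
    (hu : ∀ x, g₁ (u x) = u' (g x)) (f : V →ₗ[K] W) (t : V ⊗[K] V') :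
    descentMap L f g₁ (u.lTensor V t) = u'.lTensor W (descentMap L f g t) := by
  induction t with
  | zero => simp only [map_zero]
  | add s t hs ht => simp only [map_add, hs, ht]
  | tmul x y => simp [hu]

theorem descentMap_assoc {V'' W'' : Type*} [AddCommGroup V''] [Module K V'']
    [AddCommGroup W''] [Module K W''] [Module L W''] [IsScalarTower K L W'']
    (f : V →ₗ[K] W) (g : V' →ₗ[K] W') (h : V'' →ₗ[K] W'') (t : (V ⊗[K] V') ⊗[K] V'') :
    descentMap L f (descentMap L g h) (TensorProduct.assoc K V V' V'' t) =
      TensorProduct.assoc L W W' W'' (descentMap L (descentMap L f g) h t) := by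
  refine LinearMap.congr_fun (f := descentMap L f (descentMap L g h) ∘ₗ
    (TensorProduct.assoc K V V' V'').toLinearMap) (g := (TensorProduct.assoc L W W'
      W'').toLinearMap.restrictScalars K ∘ₗ descentMap L (descentMap L f g) h) ?_ t
  exact TensorProduct.ext_threefold fun x y z => by simp

theorem lid_descentMap (f : V →ₗ[K] W) (t : K ⊗[K] V) :
    TensorProduct.lid L W (descentMap L (Algebra.linearMap K L) f t) =
      f (TensorProduct.lid K V t) := by
  induction t with
  | zero => simp only [map_zero]
  | add s t hs ht => simp only [map_add, hs, ht]
  | tmul c x => simp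

theorem rid_descentMap (f : V →ₗ[K] W) (t : V ⊗[K] K) :
    TensorProduct.rid L W (descentMap L f (Algebra.linearMap K L) t) =
      f (TensorProduct.rid K V t) := by
  induction t with
  | zero => simp only [map_zero]
  | add s t hs ht => simp only [map_add, hs, ht]
  | tmul x c => simp

variable {H A : Type*} [Ring H] [Algebra K H] [Ring A] [Algebra K A] [Algebra L A]
  [IsScalarTower K L A]

theorem mul'_descentMap (f : H →ₐ[K] A) (t : H ⊗[K] H) :
    LinearMap.mul' L A (descentMap L f.toLinearMap f.toLinearMap t) =
      f (LinearMap.mul' K H t) := by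
  induction t with
  | zero => simp only [map_zero]
  | add s t hs ht => simp only [map_add, hs, ht]
  | tmul x y => simp

theorem descentMap_mul (f : H →ₐ[K] A) (s t : H ⊗[K] H) :
    descentMap L f.toLinearMap f.toLinearMap (s * t) =
      descentMap L f.toLinearMap f.toLinearMap s * descentMap L f.toLinearMap f.toLinearMap t := by
  induction s with
  | zero => simp only [zero_mul, map_zero]
  | add s s' hs hs' => simp only [add_mul, map_add, hs, hs']
  | tmul x y =>
    induction t with
    | zero => simp only [mul_zero, map_zero]
    | add t t' ht ht' => simp only [mul_add, map_add, ht, ht']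
    | tmul z w => simp

end DescentMap

/-- An algebra map `f : H → A` from a `K`-algebra to an `L`-Hopf algebra with `L ⊗_K H ≅ A`, such
that the Hopf algebra operations of `A` map `H` to `H ⊗_K H`, `K` and `H`: the condition under
which they turn `H` into a `K`-form of the Hopf algebra `A`. -/
structure IsHopfForm {K : Type u} (L : Type v) [Field K] [Field L] [Algebra K L]
    {H A : Type*} [Ring H] [Algebra K H] [Ring A] [Algebra K A] [HopfAlgebra L A]
    [IsScalarTower K L A] (f : H →ₐ[K] A) : Prop where
  isBaseChange : IsBaseChange L f.toLinearMap
  comul (h : H) : ∃ t, descentMap L f.toLinearMap f.toLinearMap t = Coalgebra.comul (R := L) (f h)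
  counit (h : H) : ∃ c, algebraMap K L c = Coalgebra.counit (R := L) (f h)
  antipode (h : H) : ∃ h', f h' = HopfAlgebra.antipode L (f h)

namespace IsHopfForm

variable {K : Type u} {L : Type v} [Field K] [Field L] [Algebra K L]
  {H A : Type*} [Ring H] [Algebra K H] [Ring A] [Algebra K A] [HopfAlgebra L A]
  [IsScalarTower K L A] {f : H →ₐ[K] A} (hf : IsHopfForm L f)

include hf

theorem injective : Function.Injective f := injective_of_isBaseChange hf.isBaseChange

theorem injective_descentMap : Function.Injective (descentMap L f.toLinearMap f.toLinearMap) :=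
  injective_of_isBaseChange (isBaseChange_descentMap hf.isBaseChange hf.isBaseChange)

/-- The comultiplication of `A`, restricted to the `K`-form `H`. -/
noncomputable def descendedComul : H →ₗ[K] H ⊗[K] H :=
  LinearMap.codRestrictOfInjective
    ((Coalgebra.comul (R := L) (A := A)).restrictScalars K ∘ₗ f.toLinearMap)
    (descentMap L f.toLinearMap f.toLinearMap) hf.injective_descentMap hf.comul

theorem descentMap_descendedComul (h : H) :
    descentMap L f.toLinearMap f.toLinearMap (hf.descendedComul h) =
      Coalgebra.comul (R := L) (f h) :=
  LinearMap.codRestrictOfInjective_comp_apply ..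

/-- The counit of `A`, restricted to the `K`-form `H`. -/
noncomputable def descendedCounit : H →ₗ[K] K :=
  LinearMap.codRestrictOfInjective
    ((Coalgebra.counit (R := L) (A := A)).restrictScalars K ∘ₗ f.toLinearMap)
    (Algebra.linearMap K L) (algebraMap K L).injective hf.counit

theorem algebraMap_descendedCounit (h : H) :
    algebraMap K L (hf.descendedCounit h) = Coalgebra.counit (R := L) (f h) :=
  LinearMap.codRestrictOfInjective_comp_apply (i := Algebra.linearMap K L) ..

/-- The antipode of `A`, restricted to the `K`-form `H`. -/
noncomputable def descendedAntipode : H →ₗ[K] H :=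
  LinearMap.codRestrictOfInjective
    ((HopfAlgebra.antipode L (A := A)).restrictScalars K ∘ₗ f.toLinearMap)
    f.toLinearMap hf.injective hf.antipode

theorem apply_descendedAntipode (h : H) :
    f (hf.descendedAntipode h) = HopfAlgebra.antipode L (f h) :=
  LinearMap.codRestrictOfInjective_comp_apply (i := f.toLinearMap) ..

theorem coassoc_descendedComul (h : H) :
    TensorProduct.assoc K H H H (hf.descendedComul.rTensor H (hf.descendedComul h)) =
      hf.descendedComul.lTensor H (hf.descendedComul h) := by
  apply injective_of_isBaseChange (isBaseChange_descentMap hf.isBaseChange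
    (isBaseChange_descentMap hf.isBaseChange hf.isBaseChange))
  rw [descentMap_assoc, descentMap_rTensor (f := f.toLinearMap) hf.descentMap_descendedComul,
    descentMap_lTensor (g := f.toLinearMap) hf.descentMap_descendedComul,
    hf.descentMap_descendedComul,
    Coalgebra.coassoc_apply]

theorem lid_rTensor_descendedCounit (h : H) :
    TensorProduct.lid K H (hf.descendedCounit.rTensor H (hf.descendedComul h)) = h := by
  apply hf.injective
  rw [← AlgHom.toLinearMap_apply, ← lid_descentMap (L := L),
    descentMap_rTensor (f := f.toLinearMap) (f₁ := Algebra.linearMap K L)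
      hf.algebraMap_descendedCounit,
    hf.descentMap_descendedComul, Coalgebra.rTensor_counit_comul, TensorProduct.lid_tmul, one_smul]

theorem rid_lTensor_descendedCounit (h : H) :
    TensorProduct.rid K H (hf.descendedCounit.lTensor H (hf.descendedComul h)) = h := by
  apply hf.injective
  rw [← AlgHom.toLinearMap_apply, ← rid_descentMap (L := L),
    descentMap_lTensor (g := f.toLinearMap) (g₁ := Algebra.linearMap K L)
      hf.algebraMap_descendedCounit,
    hf.descentMap_descendedComul, Coalgebra.lTensor_counit_comul, TensorProduct.rid_tmul, one_smul]

theorem mul'_rTensor_descendedAntipode (h : H) :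
    LinearMap.mul' K H (hf.descendedAntipode.rTensor H (hf.descendedComul h)) =
      algebraMap K H (hf.descendedCounit h) := by
  apply hf.injective
  rw [← mul'_descentMap (L := L), descentMap_rTensor (f := f.toLinearMap) (f₁ := f.toLinearMap)
      hf.apply_descendedAntipode,
    hf.descentMap_descendedComul, HopfAlgebra.mul_antipode_rTensor_comul_apply, f.commutes,
    IsScalarTower.algebraMap_apply K L A, hf.algebraMap_descendedCounit]

theorem mul'_lTensor_descendedAntipode (h : H) :
    LinearMap.mul' K H (hf.descendedAntipode.lTensor H (hf.descendedComul h)) =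
      algebraMap K H (hf.descendedCounit h) := by
  apply hf.injective
  rw [← mul'_descentMap (L := L), descentMap_lTensor (g := f.toLinearMap) (g₁ := f.toLinearMap)
      hf.apply_descendedAntipode,
    hf.descentMap_descendedComul, HopfAlgebra.mul_antipode_lTensor_comul_apply, f.commutes,
    IsScalarTower.algebraMap_apply K L A, hf.algebraMap_descendedCounit]

/-- The coalgebra structure on a `K`-form of the `L`-Hopf algebra `A`. -/
@[reducible] noncomputable def coalgebra : Coalgebra K H where
  comul := hf.descendedComul
  counit := hf.descendedCounit
  coassoc := LinearMap.ext hf.coassoc_descendedComul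
  rTensor_counit_comp_comul := LinearMap.ext fun h =>
    (TensorProduct.lid K H).injective <| (hf.lid_rTensor_descendedCounit h).trans (by simp)
  lTensor_counit_comp_comul := LinearMap.ext fun h =>
    (TensorProduct.rid K H).injective <| (hf.rid_lTensor_descendedCounit h).trans (by simp)

/-- The bialgebra structure on a `K`-form of the `L`-Hopf algebra `A`. -/
@[reducible] noncomputable def bialgebra : Bialgebra K H :=
  letI := hf.coalgebra
  Bialgebra.mk' K H
    ((algebraMap K L).injective <| (hf.algebraMap_descendedCounit 1).trans <| by simp)
    (fun {x y} => (algebraMap K L).injective <| (hf.algebraMap_descendedCounit _).trans <| by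
      rw [map_mul, map_mul (algebraMap K L), Bialgebra.counit_mul]
      exact (congrArg₂ _ (hf.algebraMap_descendedCounit x)
        (hf.algebraMap_descendedCounit y)).symm)
    (hf.injective_descentMap <| (hf.descentMap_descendedComul 1).trans <| by
      rw [map_one, Bialgebra.comul_one, Algebra.TensorProduct.one_def,
        Algebra.TensorProduct.one_def, descentMap_tmul, AlgHom.toLinearMap_apply, map_one])
    (fun {x y} => hf.injective_descentMap <| (hf.descentMap_descendedComul _).trans <| by
      rw [descentMap_mul, map_mul, Bialgebra.comul_mul]
      exact (congrArg₂ _ (hf.descentMap_descendedComul x)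
        (hf.descentMap_descendedComul y)).symm)

/-- The Hopf algebra structure on a `K`-form of the `L`-Hopf algebra `A`. -/
@[reducible] noncomputable def hopfAlgebra : HopfAlgebra K H :=
  { hf.bialgebra with
    antipode := hf.descendedAntipode
    mul_antipode_rTensor_comul := LinearMap.ext hf.mul'_rTensor_descendedAntipode
    mul_antipode_lTensor_comul := LinearMap.ext hf.mul'_lTensor_descendedAntipode }

end IsHopfForm

/-! ### Twisted group algebras and their fixed rings -/

section Twist

variable {K : Type u} {L : Type v} [Field K] [Field L] [Algebra K L] {N : Type w} [Group N]

/-- The semilinear action of `g ∈ Gal(L/K)` on `L[N]` attached to an action of `Gal(L/K)` on `N`. -/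
noncomputable def twist (a : Gal(L/K) →* MulAut N) (g : Gal(L/K)) :
    MonoidAlgebra L N →ₐ[K] MonoidAlgebra L N :=
  (MonoidAlgebra.mapDomainAlgHom K L (a g).toMonoidHom).comp
    (MonoidAlgebra.mapAlgHom N g.toAlgHom)

variable (a : Gal(L/K) →* MulAut N)

@[simp] theorem twist_single (g : Gal(L/K)) (ν : N) (c : L) :
    twist a g (MonoidAlgebra.single ν c) = MonoidAlgebra.single (a g ν) (g c) := by
  simp [twist]

theorem twist_smul (g : Gal(L/K)) (c : L) (w : MonoidAlgebra L N) :
    twist a g (c • w) = g c • twist a g w := by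
  induction w using MonoidAlgebra.induction_linear with
  | zero => simp only [smul_zero, map_zero]
  | add x y hx hy => simp only [smul_add, map_add, hx, hy]
  | single ν d => simp

/-- The maps `twist a g` as a semilinear action of `Gal(L/K)` on `L[N]`. -/
noncomputable def twistAction : SemilinearGaloisAction K L (MonoidAlgebra L N) where
  act g := { twist a g with map_smul' := twist_smul a g }
  act_one w := by
    induction w using MonoidAlgebra.induction_linear with
    | zero => exact map_zero _
    | add x y hx hy => rw [map_add, hx, hy]
    | single ν d => exact (twist_single a 1 ν d).trans (by simp)
  act_mul g h w := by
    induction w using MonoidAlgebra.induction_linear with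
    | zero => simp only [map_zero]
    | add x y hx hy => simp only [map_add, hx, hy]
    | single ν d => exact (twist_single a (g * h) ν d).trans (by simp [← twist_single])

@[simp] theorem twistAction_act (g : Gal(L/K)) (w : MonoidAlgebra L N) :
    (twistAction a).act g w = twist a g w := rfl

/-- The `K`-subalgebra `L[N]^G` of `L[N]` fixed by the twisted Galois action. -/
noncomputable def twistedFixed : Subalgebra K (MonoidAlgebra L N) where
  carrier := (twistAction a).invariants
  add_mem' := add_mem
  mul_mem' hv hw g := (map_mul (twist a g) _ _).trans (congrArg₂ _ (hv g) (hw g))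
  algebraMap_mem' c g := (twist a g).commutes c

theorem mem_twistedFixed {w : MonoidAlgebra L N} :
    w ∈ twistedFixed a ↔ ∀ g : Gal(L/K), twist a g w = w := Iff.rfl

/-- The natural map `L ⊗ L[N]^G → L[N]`. -/
noncomputable def twistedFixedLift : L ⊗[K] twistedFixed a →ₐ[L] MonoidAlgebra L N :=
  Algebra.TensorProduct.lift (Algebra.ofId L _) (twistedFixed a).val
    (fun c h => show Commute _ _ from Algebra.commutes c h.1)

@[simp] theorem twistedFixedLift_tmul (c : L) (h : twistedFixed a) :
    twistedFixedLift a (c ⊗ₜ h) = c • (h : MonoidAlgebra L N) := by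
  rw [twistedFixedLift, Algebra.TensorProduct.lift_tmul, Algebra.smul_def]
  rfl

theorem twistedFixedLift_map (g : Gal(L/K)) (t : L ⊗[K] twistedFixed a) :
    twistedFixedLift a (Algebra.TensorProduct.map g.toAlgHom (AlgHom.id K _) t) =
      twist a g (twistedFixedLift a t) := by
  induction t with
  | zero => simp only [map_zero]
  | add s t hs ht => simp only [map_add, hs, ht]
  | tmul c h => simp [twist_smul, (mem_twistedFixed a).mp h.2 g]

theorem comul_twist (g : Gal(L/K)) (w : MonoidAlgebra L N) :
    Coalgebra.comul (R := L) (twist a g w) =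
      ((twistAction a).tensor (twistAction a)).act g (Coalgebra.comul (R := L) w) := by
  induction w using MonoidAlgebra.induction_linear with
  | zero => simp only [map_zero]
  | add x y hx hy => simp only [map_add, hx, hy]
  | single ν d =>
    rw [twist_single, MonoidAlgebra.comul_single, MonoidAlgebra.comul_single]
    simp

theorem counit_twist (g : Gal(L/K)) (w : MonoidAlgebra L N) :
    Coalgebra.counit (R := L) (twist a g w) = g (Coalgebra.counit (R := L) w) := by
  induction w using MonoidAlgebra.induction_linear with
  | zero => simp only [map_zero]
  | add x y hx hy => simp only [map_add, hx, hy]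
  | single ν d => simp

theorem antipode_twist (g : Gal(L/K)) (w : MonoidAlgebra L N) :
    HopfAlgebra.antipode L (twist a g w) = twist a g (HopfAlgebra.antipode L w) := by
  induction w using MonoidAlgebra.induction_linear with
  | zero => simp only [map_zero]
  | add x y hx hy => simp only [map_add, hx, hy]
  | single ν d => simp

theorem descentMap_twistedFixed_mem_invariants (t : twistedFixed a ⊗[K] twistedFixed a) :
    descentMap L (twistedFixed a).val.toLinearMap (twistedFixed a).val.toLinearMap t ∈
      ((twistAction a).tensor (twistAction a)).invariants := by
  induction t with
  | zero => rw [map_zero]; exact zero_mem _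
  | add s t hs ht => rw [map_add]; exact add_mem hs ht
  | tmul h k => exact fun g => congrArg₂ (· ⊗ₜ ·) (h.2 g) (k.2 g)

variable [FiniteDimensional K L] [IsGalois K L]

theorem isBaseChange_twistedFixed : IsBaseChange L (twistedFixed a).val.toLinearMap :=
  (twistAction a).isBaseChange_invariants

theorem bijective_twistedFixedLift : Function.Bijective (twistedFixedLift a) := by
  convert (isBaseChange_twistedFixed a).equiv.bijective using 1
  refine funext fun t => ?_
  induction t with
  | zero => simp only [map_zero]
  | add s t hs ht => simp only [map_add, hs, ht]
  | tmul c h => rw [twistedFixedLift_tmul, IsBaseChange.equiv_tmul]; rfl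

theorem isHopfForm_twistedFixed : IsHopfForm L (twistedFixed a).val where
  isBaseChange := isBaseChange_twistedFixed a
  comul h := SemilinearGaloisAction.exists_eq_of_mem_invariants
    (isBaseChange_descentMap (isBaseChange_twistedFixed a) (isBaseChange_twistedFixed a))
    (descentMap_twistedFixed_mem_invariants a) fun g => by
      rw [← comul_twist, Subalgebra.coe_val, (mem_twistedFixed a).mp h.2 g]
  counit h := (IsGalois.mem_range_algebraMap_iff_fixed _).mpr fun g => by
    rw [← counit_twist a, Subalgebra.coe_val, (mem_twistedFixed a).mp h.2 g]
  antipode h := ⟨⟨HopfAlgebra.antipode L (h : MonoidAlgebra L N),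
    (mem_twistedFixed a).mpr fun g => by
      rw [← antipode_twist, (mem_twistedFixed a).mp h.2 g]⟩, rfl⟩

end Twist

/-! ### Hopf-Galois structures from twisted group algebras -/

section PairEval

variable {K : Type u} {L : Type v} [Field K] [Field L] [Algebra K L]
  {A : Type*} [AddCommGroup A] [Module L A]

/-- The functional `w ⊗ w' ↦ φ(w)(x) φ(w')(y)`. If `φ` is the action of a Hopf algebra on `L`, the
module algebra axiom says that its value on the comultiplication of `w` is `φ(w)(x y)`. -/
noncomputable def pairEval (φ : A →ₗ[L] Module.End K L) (x y : L) : A ⊗[L] A →ₗ[L] L :=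
  LinearMap.mul' L L ∘ₗ
    TensorProduct.map (LinearMap.applyₗ' L x ∘ₗ φ) (LinearMap.applyₗ' L y ∘ₗ φ)

@[simp] theorem pairEval_tmul (φ : A →ₗ[L] Module.End K L) (x y : L) (w w' : A) :
    pairEval φ x y (w ⊗ₜ w') = φ w x * φ w' y := rfl

variable [FiniteDimensional K L]

theorem eq_zero_of_forall_sum_mul_galois {c : Gal(L/K) → L} (hc : ∀ x, ∑ g, c g * g x = 0) :
    c = 0 :=
  funext <| Fintype.linearIndependent_iff.mp (linearIndependent_algEquiv_toLinearMap K L) c <|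
    LinearMap.ext fun x => by simpa using hc x

variable [IsGalois K L]

theorem eq_zero_of_forall_pairEval (φ : A ≃ₗ[L] Module.End K L) {t : A ⊗[L] A}
    (ht : ∀ x y, pairEval φ.toLinearMap x y t = 0) : t = 0 := by
  let b := (galoisBasis K L).map φ.symm
  have hb (g x) : φ (b g) x = g x := by simp [b]
  have eval (x y) : pairEval φ.toLinearMap x y t =
      ∑ g : Gal(L/K), (∑ h : Gal(L/K), (b.tensorProduct b).repr t (g, h) * h y) * g x := by
    conv_lhs => rw [← (b.tensorProduct b).sum_repr t]
    simp only [Fintype.sum_prod_type, map_sum, Finset.sum_mul]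
    refine Finset.sum_congr rfl fun g _ => Finset.sum_congr rfl fun h _ => ?_
    rw [Module.Basis.tensorProduct_apply, map_smul, pairEval_tmul]
    simp only [LinearEquiv.coe_coe, hb, smul_eq_mul]
    ring
  have coeff_eq_zero (g h) : (b.tensorProduct b).repr t (g, h) = 0 := by
    let c (g h : Gal(L/K)) := (b.tensorProduct b).repr t (g, h)
    have sum_eq_zero (y : L) : (fun g => ∑ h : Gal(L/K), c g h * h y) = 0 :=
      eq_zero_of_forall_sum_mul_galois fun x => (eval x y).symm.trans (ht x y)
    exact congrFun (eq_zero_of_forall_sum_mul_galois fun y => congrFun (sum_eq_zero y) g) h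
  exact (b.tensorProduct b).ext_elem fun i => by simp [coeff_eq_zero i.1 i.2]

end PairEval

/-- The compatibility of a bijection `e : G → N` with an action `a` of `G` on `N` that makes
`N` the additive group of a skew brace with multiplicative group `G`. -/
def IsBraceDatum {G N : Type*} [Group G] [Group N] (e : G ≃ N) (a : G →* MulAut N) : Prop :=
  ∀ τ g : G, e (τ * g) = e τ * a τ (e g)

theorem IsBraceDatum.apply_one {G N : Type*} [Group G] [Group N] {e : G ≃ N} {a : G →* MulAut N}
    (h : IsBraceDatum e a) : e 1 = 1 := by
  have := h 1 1
  rw [mul_one, MonoidHom.map_one, MulAut.one_apply] at this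
  exact mul_eq_left.mp this.symm

section BraceEnd

variable {K : Type u} {L : Type v} [Field K] [Field L] [Algebra K L] [FiniteDimensional K L]
  [IsGalois K L] {N : Type w}

/-- The `L`-linear bijection `L[N] → End_K(L)` sending `e g` to `g`. -/
noncomputable def braceEnd (e : Gal(L/K) ≃ N) : MonoidAlgebra L N ≃ₗ[L] Module.End K L :=
  (MonoidAlgebra.coeffLinearEquiv L).trans ((galoisBasis K L).reindex e).repr.symm

@[simp] theorem braceEnd_single (e : Gal(L/K) ≃ N) (ν : N) (c : L) :
    braceEnd e (MonoidAlgebra.single ν c) = c • ((e.symm ν).toLinearMap : Module.End K L) := by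
  simp [braceEnd]

theorem braceEnd_apply_one (e : Gal(L/K) ≃ N) (w : MonoidAlgebra L N) :
    braceEnd e w 1 = Coalgebra.counit (R := L) w := by
  induction w using MonoidAlgebra.induction_linear with
  | zero => simp
  | add v w hv hw => simp only [map_add, LinearMap.add_apply, hv, hw]
  | single ν c => simp

theorem pairEval_braceEnd_comul (e : Gal(L/K) ≃ N) (w : MonoidAlgebra L N) (x y : L) :
    pairEval (braceEnd e).toLinearMap x y (Coalgebra.comul (R := L) w) =
      braceEnd e w (x * y) := by
  induction w using MonoidAlgebra.induction_linear with
  | zero => simp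
  | add v w hv hw => simp only [map_add, LinearMap.add_apply, hv, hw]
  | single ν c => simp [MonoidAlgebra.comul_single, mul_left_comm]

end BraceEnd

namespace IsBraceDatum

variable {K : Type u} {L : Type v} [Field K] [Field L] [Algebra K L] [FiniteDimensional K L]
  [IsGalois K L]

section Action

variable {N : Type w} [Group N] {e : Gal(L/K) ≃ N} {a : Gal(L/K) →* MulAut N}
  (h : IsBraceDatum e a)

include h

theorem braceEnd_single_mul_twist (τ : Gal(L/K)) (c : L) (w : MonoidAlgebra L N) (y : L) :
    braceEnd e (MonoidAlgebra.single (e τ) c * twist a τ w) y = c * τ (braceEnd e w y) := by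
  induction w using MonoidAlgebra.induction_linear with
  | zero => simp
  | add v w hv hw => simp only [map_add, mul_add, LinearMap.add_apply, hv, hw]
  | single ν d =>
    obtain ⟨g, rfl⟩ := e.surjective ν
    rw [twist_single, MonoidAlgebra.single_mul_single, ← h, braceEnd_single, braceEnd_single]
    simp [mul_assoc]

theorem braceEnd_mul (w : MonoidAlgebra L N) {k : MonoidAlgebra L N} (hk : k ∈ twistedFixed a) :
    braceEnd e (w * k) = braceEnd e w * braceEnd e k := by
  ext y
  induction w using MonoidAlgebra.induction_linear with
  | zero => simp
  | add v w hv hw => simp only [add_mul, map_add, LinearMap.add_apply, hv, hw]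
  | single ν c =>
    obtain ⟨τ, rfl⟩ := e.surjective ν
    rw [← (mem_twistedFixed a).mp hk τ, h.braceEnd_single_mul_twist,
      (mem_twistedFixed a).mp hk τ, braceEnd_single]
    simp

/-- The action of `L[N]^G` on `L`. -/
noncomputable def act : twistedFixed a →ₐ[K] Module.End K L :=
  AlgHom.ofLinearMap
    ((braceEnd e).toLinearMap.restrictScalars K ∘ₗ (twistedFixed a).val.toLinearMap)
    (by
      ext y
      simp [MonoidAlgebra.one_def, ← h.apply_one])
    (fun w k => h.braceEnd_mul w.1 k.2)

@[simp] theorem act_apply (w : twistedFixed a) :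
    h.act w = braceEnd e (w : MonoidAlgebra L N) := rfl

theorem lift_act (t : L ⊗[K] twistedFixed a) :
    TensorProduct.lift
      ((LinearMap.mul K (Module.End K L)).compl₁₂ (Algebra.lmul K L).toLinearMap
        h.act.toLinearMap) t = braceEnd e (twistedFixedLift a t) := by
  induction t with
  | zero => simp only [map_zero]
  | add s t hs ht => simp only [map_add, hs, ht]
  | tmul c w =>
    ext y
    simp

theorem mul'_map_act_flip (x y : L) (t : twistedFixed a ⊗[K] twistedFixed a) :
    LinearMap.mul' K L
      (TensorProduct.map (h.act.toLinearMap.flip x) (h.act.toLinearMap.flip y) t) =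
      pairEval (braceEnd e).toLinearMap x y
        (descentMap L (twistedFixed a).val.toLinearMap (twistedFixed a).val.toLinearMap t) := by
  induction t with
  | zero => simp only [map_zero]
  | add s t hs ht => simp only [map_add, hs, ht]
  | tmul w k => simp

end Action

/-- The Hopf-Galois structure attached to a skew brace structure on the Galois group. -/
noncomputable def hopfGaloisStructure {N : Type v} [Group N] {e : Gal(L/K) ≃ N}
    {a : Gal(L/K) →* MulAut N} (h : IsBraceDatum e a) : HopfGaloisStructure K L :=
  letI := (isHopfForm_twistedFixed a).hopfAlgebra
  { H := twistedFixed a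
    act := h.act
    act_one := fun w =>
      (braceEnd_apply_one e _).trans ((isHopfForm_twistedFixed a).algebraMap_descendedCounit w).symm
    act_mul := fun w x y => by
      refine .trans ?_ (h.mul'_map_act_flip x y _).symm
      refine .trans ?_
        (congrArg _ ((isHopfForm_twistedFixed a).descentMap_descendedComul w)).symm
      exact (pairEval_braceEnd_comul e _ x y).symm
    bijective := by
      convert (braceEnd e).bijective.comp (bijective_twistedFixedLift a) using 1
      exact funext h.lift_act }

end IsBraceDatum

/-! ### Skew braces from Hopf-Galois structures -/

namespace HopfGaloisStructure

variable {K : Type u} {L : Type v} [Field K] [Field L] [Algebra K L]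
  (S : HopfGaloisStructure K L)

/-- The isomorphism `L ⊗ H ≃ End_K(L)` sending `c ⊗ h` to `x ↦ c h(x)`. -/
noncomputable def endEquiv : L ⊗[K] S.H ≃ₗ[L] Module.End K L :=
  LinearEquiv.ofBijective (S.act.toLinearMap.liftBaseChange L) <| by
    convert S.bijective
    ext1 t
    induction t with
    | zero => simp only [map_zero]
    | add s t hs ht => simp only [map_add, hs, ht]
    | tmul c h =>
      ext y
      simp

@[simp] theorem endEquiv_tmul (c : L) (h : S.H) : S.endEquiv (c ⊗ₜ h) = c • S.act h :=
  LinearMap.liftBaseChange_tmul ..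

theorem injective_act : Function.Injective S.act := by
  intro h k hhk
  have : (1 : L) ⊗ₜ[K] h = (1 : L) ⊗ₜ[K] k := S.endEquiv.injective (by simp [hhk])
  exact Algebra.TensorProduct.includeRight_injective (algebraMap K L).injective this

theorem endEquiv_mul_tmul (w : L ⊗[K] S.H) (c : L) (h : S.H) (y : L) :
    S.endEquiv (w * (c ⊗ₜ h)) y = c * S.endEquiv w (S.act h y) := by
  induction w with
  | zero => simp
  | add s t hs ht => simp only [add_mul, map_add, LinearMap.add_apply, hs, ht, mul_add]
  | tmul d k => simp [mul_assoc, mul_left_comm]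

section Coalgebra

/-- The inclusion `H ⊗_K H → (L ⊗ H) ⊗_L (L ⊗ H)`. -/
noncomputable def inclTensor : S.H ⊗[K] S.H →ₗ[K] (L ⊗[K] S.H) ⊗[L] (L ⊗[K] S.H) :=
  descentMap L (TensorProduct.mk K L S.H 1) (TensorProduct.mk K L S.H 1)

theorem injective_inclTensor : Function.Injective S.inclTensor :=
  have isBaseChange := TensorProduct.isBaseChange K S.H L
  injective_of_isBaseChange (isBaseChange_descentMap isBaseChange isBaseChange)

theorem pairEval_inclTensor (x y : L) (t : S.H ⊗[K] S.H) :
    pairEval S.endEquiv.toLinearMap x y (S.inclTensor t) =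
      LinearMap.mul' K L
        (TensorProduct.map (S.act.toLinearMap.flip x) (S.act.toLinearMap.flip y) t) := by
  induction t with
  | zero => simp only [map_zero]
  | add s t hs ht => simp only [map_add, hs, ht]
  | tmul h k => simp [inclTensor]

theorem comul_tmul (c : L) (h : S.H) :
    Coalgebra.comul (R := L) (c ⊗ₜ[K] h) = c • S.inclTensor (Coalgebra.comul (R := K) h) := by
  rw [TensorProduct.comul_tmul, CommSemiring.comul_apply]
  induction Coalgebra.comul (R := K) h with
  | zero => simp
  | add s t hs ht => rw [TensorProduct.tmul_add, map_add, hs, ht, map_add, smul_add]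
  | tmul k l =>
    have tmul_eq : c ⊗ₜ[K] l = c • ((1 : L) ⊗ₜ[K] l) := by simp [TensorProduct.smul_tmul']
    rw [TensorProduct.AlgebraTensorModule.tensorTensorTensorComm_tmul, tmul_eq,
      TensorProduct.tmul_smul]
    rfl

theorem pairEval_comul (x y : L) (w : L ⊗[K] S.H) :
    pairEval S.endEquiv.toLinearMap x y (Coalgebra.comul (R := L) w) = S.endEquiv w (x * y) := by
  induction w with
  | zero => simp
  | add s t hs ht => simp only [map_add, LinearMap.add_apply, hs, ht]
  | tmul c h =>
    rw [comul_tmul, map_smul, pairEval_inclTensor, ← S.act_mul]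
    simp

theorem counit_eq (w : L ⊗[K] S.H) : Coalgebra.counit (R := L) w = S.endEquiv w 1 := by
  induction w with
  | zero => simp
  | add s t hs ht => simp only [map_add, LinearMap.add_apply, hs, ht]
  | tmul c h => simp [S.act_one, Algebra.smul_def, mul_comm]

theorem eq_of_forall_act [FiniteDimensional K L] [IsGalois K L] {t t' : S.H ⊗[K] S.H}
    (h : ∀ x y, LinearMap.mul' K L
        (TensorProduct.map (S.act.toLinearMap.flip x) (S.act.toLinearMap.flip y) t) =
      LinearMap.mul' K L
        (TensorProduct.map (S.act.toLinearMap.flip x) (S.act.toLinearMap.flip y) t')) :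
    t = t' := by
  apply S.injective_inclTensor
  rw [← sub_eq_zero]
  refine eq_zero_of_forall_pairEval S.endEquiv fun x y => ?_
  rw [map_sub, pairEval_inclTensor, pairEval_inclTensor, h, sub_self]

end Coalgebra

section GaloisAction

/-- The semilinear action of the Galois group on `L ⊗ H` by ring automorphisms; as a semilinear
action it is `SemilinearGaloisAction.baseChange`. -/
noncomputable def galAct (τ : Gal(L/K)) : L ⊗[K] S.H →ₐ[K] L ⊗[K] S.H :=
  Algebra.TensorProduct.map τ.toAlgHom (AlgHom.id K S.H)

theorem galAct_eq_baseChange_act (τ : Gal(L/K)) (w : L ⊗[K] S.H) :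
    S.galAct τ w = (SemilinearGaloisAction.baseChange K L S.H).act τ w := rfl

@[simp] theorem galAct_tmul (τ : Gal(L/K)) (c : L) (h : S.H) :
    S.galAct τ (c ⊗ₜ h) = τ c ⊗ₜ h := rfl

theorem galAct_smul (τ : Gal(L/K)) (c : L) (w : L ⊗[K] S.H) :
    S.galAct τ (c • w) = τ c • S.galAct τ w :=
  map_smulₛₗ ((SemilinearGaloisAction.baseChange K L S.H).act τ) c w

theorem galAct_mul (τ g : Gal(L/K)) (w : L ⊗[K] S.H) :
    S.galAct (τ * g) w = S.galAct τ (S.galAct g w) :=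
  (SemilinearGaloisAction.baseChange K L S.H).act_mul τ g w

theorem galAct_one (w : L ⊗[K] S.H) : S.galAct 1 w = w :=
  (SemilinearGaloisAction.baseChange K L S.H).act_one w

/-- The element of `L ⊗ H` that acts on `L` as the automorphism `g`. -/
noncomputable def autElem (g : Gal(L/K)) : L ⊗[K] S.H :=
  S.endEquiv.symm g.toLinearMap

@[simp] theorem endEquiv_autElem (g : Gal(L/K)) : S.endEquiv (S.autElem g) = g.toLinearMap :=
  S.endEquiv.apply_symm_apply _

theorem endEquiv_mul_galAct (τ : Gal(L/K)) (w : L ⊗[K] S.H) (y : L) :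
    S.endEquiv (S.autElem τ * S.galAct τ w) y = τ (S.endEquiv w y) := by
  induction w with
  | zero => simp
  | add s t hs ht => simp only [map_add, mul_add, LinearMap.add_apply, hs, ht]
  | tmul c h => simp [endEquiv_mul_tmul]

theorem autElem_mul (τ g : Gal(L/K)) :
    S.autElem (τ * g) = S.autElem τ * S.galAct τ (S.autElem g) := by
  apply S.endEquiv.injective
  ext y
  simp [endEquiv_mul_galAct]

end GaloisAction

section GroupLike

variable [FiniteDimensional K L] [IsGalois K L]

theorem isGroupLikeElem_autElem (g : Gal(L/K)) : IsGroupLikeElem L (S.autElem g) where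
  counit_eq_one := by simp [counit_eq]
  comul_eq_tmul_self := by
    rw [← sub_eq_zero]
    refine eq_zero_of_forall_pairEval S.endEquiv fun x y => ?_
    rw [map_sub, pairEval_comul, pairEval_tmul]
    simp

theorem exists_autElem_eq {w : L ⊗[K] S.H} (hw : IsGroupLikeElem L w) : ∃ g, S.autElem g = w := by
  have map_one : S.endEquiv w 1 = 1 := by rw [← counit_eq, hw.counit_eq_one]
  have map_mul (x y) : S.endEquiv w (x * y) = S.endEquiv w x * S.endEquiv w y := by
    rw [← pairEval_comul, hw.comul_eq_tmul_self, pairEval_tmul]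
    rfl
  let f : L →ₐ[K] L := AlgHom.ofLinearMap (S.endEquiv w) map_one map_mul
  refine ⟨AlgEquiv.ofBijective f (Algebra.IsAlgebraic.algHom_bijective f), ?_⟩
  apply S.endEquiv.injective
  rw [endEquiv_autElem]
  rfl

/-- The bijection from the Galois group to the group-like elements of `L ⊗ H`. -/
noncomputable def autEquiv : Gal(L/K) ≃ GroupLike L (L ⊗[K] S.H) :=
  Equiv.ofBijective (fun g => ⟨S.autElem g, S.isGroupLikeElem_autElem g⟩)
    ⟨fun _ _ h => AlgEquiv.toLinearMap_injective
        (S.endEquiv.symm.injective (congrArg GroupLike.val h)),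
      fun w => (S.exists_autElem_eq w.2).imp fun _ hg => GroupLike.ext hg⟩

@[simp] theorem val_autEquiv (g : Gal(L/K)) : (S.autEquiv g).val = S.autElem g := rfl

theorem isGroupLikeElem_galAct (τ : Gal(L/K)) {w : L ⊗[K] S.H} (hw : IsGroupLikeElem L w) :
    IsGroupLikeElem L (S.galAct τ w) := by
  obtain ⟨g, rfl⟩ := S.exists_autElem_eq hw
  have inv_mul : (S.autEquiv τ)⁻¹.val * S.autElem τ = 1 := by
    rw [← val_autEquiv, ← GroupLike.val_mul, inv_mul_cancel, GroupLike.val_one]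
  have galAct_eq : S.galAct τ (S.autElem g) = ((S.autEquiv τ)⁻¹ * S.autEquiv (τ * g)).val := by
    rw [GroupLike.val_mul, val_autEquiv, autElem_mul, ← mul_assoc, inv_mul, one_mul]
  rw [galAct_eq]
  exact GroupLike.isGroupLikeElem_val _

/-- The action of the Galois group on the group-like elements of `L ⊗ H`. -/
noncomputable def groupLikeAct : Gal(L/K) →* MulAut (GroupLike L (L ⊗[K] S.H)) where
  toFun τ :=
    { toFun := fun w => ⟨S.galAct τ w.val, S.isGroupLikeElem_galAct τ w.2⟩
      invFun := fun w => ⟨S.galAct τ⁻¹ w.val, S.isGroupLikeElem_galAct τ⁻¹ w.2⟩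
      left_inv := fun w => by
        ext
        simp [← galAct_mul, galAct_one]
      right_inv := fun w => by
        ext
        simp [← galAct_mul, galAct_one]
      map_mul' := fun v w => by
        ext
        simp }
  map_one' := by
    ext w
    simp [galAct_one]
  map_mul' τ g := by
    ext w
    simp [galAct_mul]

theorem val_groupLikeAct (τ : Gal(L/K)) (w : GroupLike L (L ⊗[K] S.H)) :
    (S.groupLikeAct τ w).val = S.galAct τ w.val := rfl

theorem isBraceDatum : IsBraceDatum S.autEquiv S.groupLikeAct := fun τ g => by
  ext
  rw [GroupLike.val_mul, val_groupLikeAct]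
  exact S.autElem_mul τ g

end GroupLike

end HopfGaloisStructure

/-! ### Skew braces with cyclic multiplicative group of odd prime power order -/

section GeomOrbit

section ZModAlgebra

variable {p : ℕ} [Fact p.Prime] {R : Type*} [Ring R] [Algebra (ZMod p) R]

open Polynomial

theorem sub_one_pow_prime_pow (x : R) (m : ℕ) : (x - 1) ^ p ^ m = x ^ p ^ m - 1 := by
  simpa using congrArg (aeval x) (sub_pow_char_pow (X : (ZMod p)[X]) 1 (p := p) (n := m))

theorem geom_sum_prime_pow_eq_sub_one_pow (x : R) (m : ℕ) :
    ∑ i ∈ Finset.range (p ^ m), x ^ i = (x - 1) ^ (p ^ m - 1) := by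
  have polynomial_eq :
      ∑ i ∈ Finset.range (p ^ m), (X : (ZMod p)[X]) ^ i = (X - 1) ^ (p ^ m - 1) := by
    refine mul_right_cancel₀ (b := (X - 1 : (ZMod p)[X]))
      (by simpa using X_sub_C_ne_zero (1 : ZMod p)) ?_
    rw [geom_sum_mul, ← pow_succ, Nat.sub_add_cancel (pow_pos (Fact.out : p.Prime).pos _),
      sub_one_pow_prime_pow]
  simpa using congrArg (aeval x) polynomial_eq

end ZModAlgebra

theorem pow_finrank_eq_zero_of_isNilpotent {k V : Type*} [Field k] [AddCommGroup V] [Module k V]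
    [FiniteDimensional k V] {A : Module.End k V} (hA : IsNilpotent A) :
    A ^ Module.finrank k V = 0 := by
  have h := LinearMap.aeval_self_charpoly A
  rwa [hA.charpoly_eq_X_pow_finrank, map_pow, Polynomial.aeval_X] at h

theorem natCard_le_of_geom_orbit_surjective {R V : Type*} [Ring R] [AddCommGroup V] [Module R V]
    {A : Module.End R V} {q : ℕ} (hq : 0 < q) (hA : ∑ i ∈ Finset.range q, A ^ i = 0) {b : V}
    (hsurj : Function.Surjective fun k : ℕ => (∑ i ∈ Finset.range k, A ^ i) b) :
    Nat.card V ≤ q := by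
  have pow_eq_one : A ^ q = 1 := by
    rw [← sub_eq_zero, ← geom_sum_mul, hA, zero_mul]
  have periodic : Function.Periodic (fun k : ℕ => (∑ i ∈ Finset.range k, A ^ i) b) q := by
    intro k
    simp only [add_comm k, Finset.sum_range_add, hA, zero_add, pow_add, pow_eq_one, one_mul]
  have surjective_fin :
      Function.Surjective fun j : Fin q => (∑ i ∈ Finset.range j, A ^ i) b := fun v => by
    obtain ⟨k, rfl⟩ := hsurj v
    exact ⟨⟨k % q, Nat.mod_lt k hq⟩, periodic.map_mod_nat k⟩
  simpa using Nat.card_le_card_of_surjective _ surjective_fin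

theorem eq_one_of_geom_orbit_surjective {p : ℕ} [hp : Fact p.Prime] (hodd : Odd p) {V : Type*}
    [AddCommGroup V] [Module (ZMod p) V] [Finite V] {A : Module.End (ZMod p) V}
    (hA : IsNilpotent (A - 1)) {b : V}
    (hsurj : Function.Surjective fun k : ℕ => (∑ i ∈ Finset.range k, A ^ i) b) : A = 1 := by
  have : Module.Finite (ZMod p) V := Module.Finite.of_finite
  have hcard : Nat.card V = p ^ Module.finrank (ZMod p) V := by
    rw [Module.natCard_eq_pow_finrank (K := ZMod p), Nat.card_zmod]
  have hpow := pow_finrank_eq_zero_of_isNilpotent hA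
  rcases Nat.lt_or_ge (Module.finrank (ZMod p) V) 2 with hlt | hge
  · rw [← sub_eq_zero, ← pow_one (A - 1)]
    exact pow_eq_zero_of_le (Nat.le_of_lt_succ hlt) hpow
  · exfalso
    obtain ⟨m, hm⟩ := Nat.exists_eq_add_of_le' hge
    rw [hm] at hcard hpow
    have three_le : 3 ≤ p := by
      have := hp.out.two_le
      have := hp.out.eq_one_or_self_of_dvd 2
      grind
    have bernoulli : 1 + (m + 1) * 2 ≤ p ^ (m + 1) :=
      (one_add_mul_le_pow_of_sq_nonneg (by simp) (by simp) (by simp) (m + 1)).trans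
        (Nat.pow_le_pow_left three_le _)
    have geom_sum_eq_zero : ∑ i ∈ Finset.range (p ^ (m + 1)), A ^ i = 0 := by
      rw [geom_sum_prime_pow_eq_sub_one_pow]
      exact pow_eq_zero_of_le (by omega) hpow
    have hle := natCard_le_of_geom_orbit_surjective (pow_pos hp.out.pos _) geom_sum_eq_zero hsurj
    rw [hcard, Nat.pow_le_pow_iff_right hp.out.one_lt] at hle
    omega

end GeomOrbit

section Frattini

variable {p : ℕ} [Fact p.Prime] {N : Type*} [Group N] [Finite N] (hN : IsPGroup p N)

include hN

theorem natCard_quotient_of_isCoatom {M : Subgroup N} [M.Normal] (hM : IsCoatom M) :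
    Nat.card (N ⧸ M) = p := by
  have : Nontrivial (N ⧸ M) := QuotientGroup.nontrivial_iff.mpr hM.1
  have hdvd : p ∣ Nat.card (N ⧸ M) :=
    (hN.to_quotient M).card_eq_or_dvd.resolve_left (Finite.one_lt_card.ne')
  obtain ⟨x, hx⟩ := exists_prime_orderOf_dvd_card' p hdvd
  have hlt : M < (Subgroup.zpowers x).comap (QuotientGroup.mk' M) := by
    refine lt_of_le_of_ne (fun y hy => ?_) fun heq => ?_
    · rw [Subgroup.mem_comap, QuotientGroup.mk'_apply, (QuotientGroup.eq_one_iff y).mpr hy]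
      exact one_mem _
    · have hbot : Subgroup.zpowers x = ⊥ := by
        rw [← Subgroup.map_comap_eq_self_of_surjective (QuotientGroup.mk'_surjective M)
          (Subgroup.zpowers x), ← heq, QuotientGroup.map_mk'_self]
      rw [Subgroup.zpowers_eq_bot.mp hbot, orderOf_one] at hx
      exact (Fact.out : p.Prime).one_lt.ne hx
  have htop : Subgroup.zpowers x = ⊤ := by
    rw [← Subgroup.map_comap_eq_self_of_surjective (QuotientGroup.mk'_surjective M)
      (Subgroup.zpowers x), hM.2 _ hlt,
      Subgroup.map_top_of_surjective _ (QuotientGroup.mk'_surjective M)]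
  rw [← hx, ← Nat.card_zpowers, htop, Subgroup.card_top]

theorem normal_of_isCoatom {M : Subgroup N} (hM : IsCoatom M) : M.Normal :=
  have := hN.isNilpotent
  Subgroup.NormalizerCondition.normal_of_coatom M Group.normalizerCondition_of_isNilpotent hM

theorem pow_mem_frattini (x : N) : x ^ p ∈ frattini N := by
  simp only [frattini, Order.radical, Subgroup.mem_iInf]
  intro M hM
  have := normal_of_isCoatom hN hM
  rw [← QuotientGroup.eq_one_iff, QuotientGroup.mk_pow, ← natCard_quotient_of_isCoatom hN hM,
    pow_card_eq_one']

theorem mk_frattini_mul_comm (x y : N) : (x * y : N ⧸ frattini N) = y * x := by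
  rw [← QuotientGroup.mk_mul, ← QuotientGroup.mk_mul, QuotientGroup.eq]
  simp only [frattini, Order.radical, Subgroup.mem_iInf]
  intro M hM
  have := normal_of_isCoatom hN hM
  have : IsCyclic (N ⧸ M) := isCyclic_of_prime_card (natCard_quotient_of_isCoatom hN hM)
  rw [← QuotientGroup.eq, QuotientGroup.mk_mul, QuotientGroup.mk_mul]
  exact mul_comm' _ _

end Frattini

theorem mulAut_pow_apply {N : Type*} [Group N] {α : MulAut N} {ν : N} {x : ℕ} (h : α ν = ν ^ x)
    (k : ℕ) : (α ^ k) ν = ν ^ x ^ k := by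
  induction k with
  | zero => simp
  | succ k ih => rw [pow_succ, MulAut.mul_apply, h, map_pow, ih, ← pow_mul, pow_succ]

theorem pow_apply_ofMul {N R V : Type*} [Group N] [Ring R] [AddCommGroup V] [Module R V]
    {f : Additive N →+ V} {A : Module.End R V} {α : MulAut N}
    (hA : ∀ ν, A (f (.ofMul ν)) = f (.ofMul (α ν))) (k : ℕ) (ν : N) :
    (A ^ k) (f (.ofMul ν)) = f (.ofMul ((α ^ k) ν)) := by
  induction k generalizing ν with
  | zero => rfl
  | succ k ih => rw [pow_succ, pow_succ, Module.End.mul_apply, hA, ih, MulAut.mul_apply]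

namespace IsBraceDatum

variable {G N : Type*} [Group G] [Group N] {e : G ≃ N} {a : G →* MulAut N}
  (h : IsBraceDatum e a)

include h

theorem apply_pow_succ (σ : G) (k : ℕ) : e (σ ^ (k + 1)) = e (σ ^ k) * (a σ ^ k) (e σ) := by
  rw [pow_succ, h, map_pow a]

theorem map_apply_pow {R V : Type*} [Ring R] [AddCommGroup V] [Module R V] {σ : G}
    {f : Additive N →+ V} {A : Module.End R V}
    (hA : ∀ ν, A (f (.ofMul ν)) = f (.ofMul (a σ ν))) (k : ℕ) :
    f (.ofMul (e (σ ^ k))) = (∑ i ∈ Finset.range k, A ^ i) (f (.ofMul (e σ))) := by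
  induction k with
  | zero => simp [h.apply_one]
  | succ k ih =>
    rw [Finset.sum_range_succ, LinearMap.add_apply, pow_apply_ofMul hA, ← ih, h.apply_pow_succ,
      ofMul_mul, map_add]

theorem apply_pow {σ : G} {x : ℕ} (hx : a σ (e σ) = e σ ^ x) (k : ℕ) :
    e (σ ^ k) = e σ ^ ∑ i ∈ Finset.range k, x ^ i := by
  induction k with
  | zero => simp [h.apply_one]
  | succ k ih => rw [h.apply_pow_succ, ih, mulAut_pow_apply hx, Finset.sum_range_succ, pow_add]

omit h [Group N] in
theorem exists_apply_pow_eq [Finite G] {σ : G} (hσ : ∀ g, g ∈ Subgroup.zpowers σ) (ν : N) :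
    ∃ k : ℕ, e (σ ^ k) = ν := by
  obtain ⟨k, hk⟩ := mem_powers_iff_mem_zpowers.mpr (hσ (e.symm ν))
  exact ⟨k, (congrArg e hk).trans (e.apply_symm_apply ν)⟩

section PGroup

variable {p : ℕ} [Fact p.Prime] (hodd : Odd p) [Finite G] (hG : IsPGroup p G) {σ : G}
  (hσ : ∀ g, g ∈ Subgroup.zpowers σ)

include hodd hG hσ

theorem exists_nsmul_eq_of_surjective {V : Type*} [AddCommGroup V] [Module (ZMod p) V] [Finite V]
    {f : Additive N →+ V} (hf : Function.Surjective f) {A : Module.End (ZMod p) V}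
    (hA : ∀ ν, A (f (.ofMul ν)) = f (.ofMul (a σ ν))) (v : V) :
    ∃ k : ℕ, k • f (.ofMul (e σ)) = v := by
  have orbit_surjective :
      Function.Surjective fun k : ℕ => (∑ i ∈ Finset.range k, A ^ i) (f (.ofMul (e σ))) := by
    intro w
    obtain ⟨ν, rfl⟩ := hf w
    obtain ⟨k, hk⟩ := exists_apply_pow_eq (e := e) hσ ν.toMul
    exact ⟨k, (h.map_apply_pow hA k).symm.trans (congrArg (fun μ => f (.ofMul μ)) hk)⟩
  have nilpotent : IsNilpotent (A - 1) := by
    obtain ⟨n, hn⟩ := hG.exists_card_eq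
    refine ⟨p ^ n, ?_⟩
    rw [sub_one_pow_prime_pow, sub_eq_zero]
    ext w
    obtain ⟨ν, rfl⟩ := hf w
    exact (pow_apply_ofMul hA _ ν.toMul).trans (by simp [← map_pow, ← hn])
  obtain ⟨k, hk⟩ := orbit_surjective v
  refine ⟨k, ?_⟩
  simpa [eq_one_of_geom_orbit_surjective hodd nilpotent orbit_surjective] using hk

theorem zpowers_apply_eq_top : Subgroup.zpowers (e σ) = ⊤ := by
  have : Finite N := Finite.of_equiv G e
  obtain ⟨n, hn⟩ := hG.exists_card_eq
  have hN : IsPGroup p N := IsPGroup.of_card ((Nat.card_congr e).symm.trans hn)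
  let : CommGroup (N ⧸ frattini N) :=
    { (inferInstance : Group (N ⧸ frattini N)) with
      mul_comm := by
        rintro ⟨x⟩ ⟨y⟩
        exact mk_frattini_mul_comm hN x y }
  let : Module (ZMod p) (Additive (N ⧸ frattini N)) := AddCommGroup.zmodModule fun x => by
    obtain ⟨y, rfl⟩ := QuotientGroup.mk_surjective x
    exact (QuotientGroup.eq_one_iff _).mpr (pow_mem_frattini hN y)
  let A : N ⧸ frattini N →* N ⧸ frattini N := QuotientGroup.map _ _ (a σ).toMonoidHom
    (frattini_le_comap_frattini_of_surjective (a σ).surjective)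
  refine frattini_nongenerating (eq_top_iff.mpr fun ν _ => ?_)
  obtain ⟨k, hk⟩ := h.exists_nsmul_eq_of_surjective hodd hG hσ
    (f := (QuotientGroup.mk' (frattini N)).toAdditive) (QuotientGroup.mk'_surjective (frattini N))
    (A := A.toAdditive.toZModLinearMap p) (fun _ => rfl) (.ofMul (QuotientGroup.mk ν))
  have hmem : (e σ ^ k)⁻¹ * ν ∈ frattini N := QuotientGroup.eq.mp hk
  rw [← mul_inv_cancel_left (e σ ^ k) ν]
  exact Subgroup.mul_mem_sup (Subgroup.pow_mem _ (Subgroup.mem_zpowers _) k) hmem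

theorem orderOf_apply : orderOf (e σ) = Nat.card G := by
  rw [Nat.card_congr e, ← Nat.card_zpowers, h.zpowers_apply_eq_top hodd hG hσ, Subgroup.card_top]

theorem exists_exponent [Nontrivial G] : ∃ x : ℕ, x ≡ 1 [MOD p] ∧ a σ (e σ) = e σ ^ x := by
  have : Finite N := Finite.of_equiv G e
  obtain ⟨x, hx⟩ : a σ (e σ) ∈ Submonoid.powers (e σ) := by
    rw [mem_powers_iff_mem_zpowers, h.zpowers_apply_eq_top hodd hG hσ]
    trivial
  refine ⟨x, ?_, hx.symm⟩
  obtain ⟨n, hn, hcard⟩ := hG.nontrivial_iff_card.mp ‹_›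
  have hpow : e σ ^ ∑ i ∈ Finset.range (Nat.card G), x ^ i = 1 := by
    rw [← h.apply_pow hx.symm, pow_card_eq_one', h.apply_one]
  have hdvd := orderOf_dvd_of_pow_eq_one hpow
  rw [h.orderOf_apply hodd hG hσ, hcard] at hdvd
  have hzero := (CharP.cast_eq_zero_iff (ZMod p) p _).mpr ((dvd_pow_self p hn.ne').trans hdvd)
  simp only [Nat.cast_sum, Nat.cast_pow] at hzero
  rw [geom_sum_prime_pow_eq_sub_one_pow] at hzero
  rw [← ZMod.natCast_eq_natCast_iff, Nat.cast_one]
  exact sub_eq_zero.mp (eq_zero_of_pow_eq_zero hzero)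

end PGroup

theorem act_apply_eq_iff_modEq {σ : G} {x : ℕ} (hx : a σ (e σ) = e σ ^ x) (k l : ℕ) :
    a σ (e (σ ^ k)) = e (σ ^ l) ↔
      x * ∑ i ∈ Finset.range k, x ^ i ≡ ∑ i ∈ Finset.range l, x ^ i [MOD orderOf (e σ)] := by
  rw [h.apply_pow hx, h.apply_pow hx, map_pow, hx, ← pow_mul, pow_eq_pow_iff_modEq]

theorem act_apply_eq_of_exponent_eq [Finite G] {N' : Type*} [Group N'] {e' : G ≃ N'}
    {a' : G →* MulAut N'} (h' : IsBraceDatum e' a') {σ : G} (hσ : ∀ g, g ∈ Subgroup.zpowers σ)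
    (hord : orderOf (e σ) = orderOf (e' σ)) {x : ℕ} (hx : a σ (e σ) = e σ ^ x)
    (hx' : a' σ (e' σ) = e' σ ^ x) {g g' : G} (hg : a σ (e g) = e g') : a' σ (e' g) = e' g' := by
  obtain ⟨k, rfl⟩ := mem_powers_iff_mem_zpowers.mpr (hσ g)
  obtain ⟨l, rfl⟩ := mem_powers_iff_mem_zpowers.mpr (hσ g')
  exact (h'.act_apply_eq_iff_modEq hx' k l).mpr (hord ▸ (h.act_apply_eq_iff_modEq hx k l).mp hg)

end IsBraceDatum

/-! ### Classification of Hopf-Galois structures by their exponent -/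

theorem SemilinearGaloisAction.mem_invariants_of_act_eq {K : Type u} {L : Type v} [Field K]
    [Field L] [Algebra K L] [FiniteDimensional K L] {W : Type*} [AddCommGroup W] [Module K W]
    [Module L W] [IsScalarTower K L W] (ρ : SemilinearGaloisAction K L W) {σ : Gal(L/K)}
    (hσ : ∀ g, g ∈ Subgroup.zpowers σ) {w : W} (hw : ρ.act σ w = w) : w ∈ ρ.invariants := by
  intro g
  obtain ⟨k, rfl⟩ := mem_powers_iff_mem_zpowers.mpr (hσ g)
  induction k with
  | zero => exact (congrArg (fun g => ρ.act g w) (pow_zero σ)).trans (ρ.act_one w)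
  | succ k ih =>
    refine (congrArg (fun g => ρ.act g w) (pow_succ σ k)).trans ?_
    rw [ρ.act_mul, hw]
    exact ih

namespace HopfGaloisStructure

variable {K : Type u} {L : Type v} [Field K] [Field L] [Algebra K L] [FiniteDimensional K L]
  [IsGalois K L] (S T : HopfGaloisStructure K L)

/-- `S` has exponent `x` with respect to `σ` if `σ` acts on the group-like element of `L ⊗ H`
corresponding to `σ` as raising to the power `x`. -/
def HasExponent (σ : Gal(L/K)) (x : ℕ) : Prop :=
  S.groupLikeAct σ (S.autEquiv σ) = S.autEquiv σ ^ x

theorem hasExponent_iff {σ : Gal(L/K)} {x : ℕ} :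
    S.HasExponent σ x ↔ S.galAct σ (S.autElem σ) = S.autElem σ ^ x := by
  rw [HasExponent, ← GroupLike.val_inj, val_groupLikeAct, GroupLike.val_pow, val_autEquiv]

theorem eq_sum_autElem (w : L ⊗[K] S.H) :
    w = ∑ g, (galoisBasis K L).repr (S.endEquiv w) g • S.autElem g := by
  apply S.endEquiv.injective
  simpa using ((galoisBasis K L).sum_repr (S.endEquiv w)).symm

variable {S T}

theorem HasExponent.congr {σ : Gal(L/K)} {x : ℕ} (h : S.HasExponent σ x)
    (e : isoSetoid K L S T) : T.HasExponent σ x := by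
  obtain ⟨φ, hφ⟩ := e
  let Φ : L ⊗[K] S.H →ₐ[K] L ⊗[K] T.H :=
    Algebra.TensorProduct.map (AlgHom.id K L) (φ : S.H →ₐ[K] T.H)
  have endEquiv_map (w) : T.endEquiv (Φ w) = S.endEquiv w := by
    induction w with
    | zero => simp
    | add s t hs ht => rw [map_add, map_add, hs, ht, map_add]
    | tmul c h =>
      ext y
      simp [Φ, hφ]
  have map_galAct (w) : Φ (S.galAct σ w) = T.galAct σ (Φ w) := by
    induction w with
    | zero => simp
    | add s t hs ht => simp only [map_add, hs, ht]
    | tmul c h => simp [Φ]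
  have map_autElem : Φ (S.autElem σ) = T.autElem σ := by
    apply T.endEquiv.injective
    rw [endEquiv_map, endEquiv_autElem, endEquiv_autElem]
  rw [hasExponent_iff] at h ⊢
  rw [← map_autElem, ← map_galAct, h, map_pow]

theorem range_act_le {σ : Gal(L/K)} (hσ : ∀ g, g ∈ Subgroup.zpowers σ)
    (h : ∀ g g', S.groupLikeAct σ (S.autEquiv g) = S.autEquiv g' →
      T.groupLikeAct σ (T.autEquiv g) = T.autEquiv g') : S.act.range ≤ T.act.range := by
  rintro _ ⟨k, rfl⟩
  let Θ := S.endEquiv.trans T.endEquiv.symm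
  have map_autElem (g) : Θ (S.autElem g) = T.autElem g := by simp [Θ, autElem]
  have map_galAct_autElem (g) : Θ (S.galAct σ (S.autElem g)) = T.galAct σ (T.autElem g) := by
    obtain ⟨g', hg'⟩ := S.autEquiv.surjective (S.groupLikeAct σ (S.autEquiv g))
    have hS : S.galAct σ (S.autElem g) = S.autElem g' := congrArg GroupLike.val hg'.symm
    have hT : T.galAct σ (T.autElem g) = T.autElem g' :=
      congrArg GroupLike.val (h g g' hg'.symm)
    rw [hS, hT, map_autElem]
  have map_galAct (w) : Θ (S.galAct σ w) = T.galAct σ (Θ w) := by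
    rw [S.eq_sum_autElem w]
    simp only [map_sum, galAct_smul, map_smul, map_galAct_autElem, map_autElem]
  obtain ⟨l, hl⟩ := SemilinearGaloisAction.exists_one_tmul_eq <|
    (SemilinearGaloisAction.baseChange K L T.H).mem_invariants_of_act_eq hσ
      (w := Θ (1 ⊗ₜ k)) (by
        rw [← galAct_eq_baseChange_act, ← map_galAct, galAct_tmul, map_one])
  exact ⟨l, by simpa [Θ] using congrArg T.endEquiv hl⟩

theorem isoSetoid_of_algEquiv (φ : S.H ≃ₐ[K] T.H) (hφ : ∀ k, T.act (φ k) = S.act k) :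
    isoSetoid K L S T := by
  have mul'_map (x y : L) (t : S.H ⊗[K] S.H) :
      LinearMap.mul' K L (TensorProduct.map (T.act.toLinearMap.flip x) (T.act.toLinearMap.flip y)
        (Algebra.TensorProduct.map (φ : S.H →ₐ[K] T.H) (φ : S.H →ₐ[K] T.H) t)) =
      LinearMap.mul' K L
        (TensorProduct.map (S.act.toLinearMap.flip x) (S.act.toLinearMap.flip y) t) := by
    induction t with
    | zero => simp only [map_zero]
    | add s t hs ht => simp only [map_add, hs, ht]
    | tmul k l => simp [hφ]
  refine ⟨BialgEquiv.ofAlgEquiv φ ?_ ?_, fun k x => by rw [← hφ]; rfl⟩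
  · ext k
    exact (algebraMap K L).injective
      ((T.act_one (φ k)).symm.trans ((congrArg (· 1) (hφ k)).trans (S.act_one k)))
  · ext k
    refine T.eq_of_forall_act fun x y => (mul'_map x y _).trans ?_
    refine (S.act_mul k x y).symm.trans ?_
    rw [← hφ]
    exact T.act_mul (φ k) x y

theorem isoSetoid_of_range_act_eq (h : S.act.range = T.act.range) : isoSetoid K L S T :=
  isoSetoid_of_algEquiv
    ((AlgEquiv.ofInjective S.act S.injective_act).trans
      ((Subalgebra.equivOfEq _ _ h).trans (AlgEquiv.ofInjective T.act T.injective_act).symm))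
    fun k => (AlgEquiv.ofInjective_apply T.act T.injective_act _).symm.trans (by simp)

section Cyclic

variable {p : ℕ} [Fact p.Prime] (hodd : Odd p) (hG : IsPGroup p Gal(L/K)) {σ : Gal(L/K)}
  (hσ : ∀ g, g ∈ Subgroup.zpowers σ) {x y : ℕ}

include hodd hG hσ

theorem isoSetoid_of_hasExponent (hS : S.HasExponent σ x) (hT : T.HasExponent σ x) :
    isoSetoid K L S T := by
  have hord : orderOf (S.autEquiv σ) = orderOf (T.autEquiv σ) :=
    (S.isBraceDatum.orderOf_apply hodd hG hσ).trans
      (T.isBraceDatum.orderOf_apply hodd hG hσ).symm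
  exact isoSetoid_of_range_act_eq <| le_antisymm
    (range_act_le hσ fun _ _ =>
      S.isBraceDatum.act_apply_eq_of_exponent_eq T.isBraceDatum hσ hord hS hT)
    (range_act_le hσ fun _ _ =>
      T.isBraceDatum.act_apply_eq_of_exponent_eq S.isBraceDatum hσ hord.symm hT hS)

theorem HasExponent.iff_modEq (hx : S.HasExponent σ x) :
    S.HasExponent σ y ↔ x ≡ y [MOD Nat.card Gal(L/K)] := by
  rw [← S.isBraceDatum.orderOf_apply hodd hG hσ, ← pow_eq_pow_iff_modEq]
  exact ⟨fun hy => hx.symm.trans hy, fun hxy => hx.trans hxy⟩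

end Cyclic

end HopfGaloisStructure

namespace IsBraceDatum

variable {K : Type u} {L : Type v} [Field K] [Field L] [Algebra K L] [FiniteDimensional K L]
  [IsGalois K L] {N : Type v} [Group N] {e : Gal(L/K) ≃ N} {a : Gal(L/K) →* MulAut N}
  (h : IsBraceDatum e a)

theorem endEquiv_hopfGaloisStructure (t : L ⊗[K] twistedFixed a) :
    h.hopfGaloisStructure.endEquiv t = braceEnd e (twistedFixedLift a t) := by
  induction t with
  | zero => exact (map_zero h.hopfGaloisStructure.endEquiv).trans (by simp only [map_zero])
  | add s t hs ht =>
    refine (map_add h.hopfGaloisStructure.endEquiv s t).trans ((congrArg₂ _ hs ht).trans ?_)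
    rw [map_add, map_add]
  | tmul c w =>
    exact (h.hopfGaloisStructure.endEquiv_tmul c w).trans
      (by rw [twistedFixedLift_tmul, map_smul]; rfl)

theorem twistedFixedLift_autElem (σ : Gal(L/K)) :
    twistedFixedLift a (h.hopfGaloisStructure.autElem σ) = MonoidAlgebra.single (e σ) 1 := by
  apply (braceEnd e).injective
  refine (h.endEquiv_hopfGaloisStructure _).symm.trans ?_
  exact (h.hopfGaloisStructure.endEquiv_autElem σ).trans (by simp)

theorem hasExponent {σ : Gal(L/K)} {x : ℕ} (hx : a σ (e σ) = e σ ^ x) :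
    h.hopfGaloisStructure.HasExponent σ x := by
  rw [HopfGaloisStructure.hasExponent_iff]
  apply (bijective_twistedFixedLift a).1
  refine (twistedFixedLift_map a σ _).trans ?_
  refine .trans ?_ (map_pow (twistedFixedLift a) (h.hopfGaloisStructure.autElem σ) x).symm
  refine .trans ?_ (congrArg (· ^ x) (h.twistedFixedLift_autElem σ)).symm
  rw [h.twistedFixedLift_autElem, twist_single, hx, MonoidAlgebra.single_pow, map_one, one_pow]

end IsBraceDatum

/-! ### The fixed rings `L[α_s(N)]^G` as twisted group algebras -/

section Equivariant

variable {K : Type u} {L : Type v} [Field K] [Field L] [Algebra K L] {N N' : Type*} [Group N]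
  [Group N'] {a : Gal(L/K) →* MulAut N} {a' : Gal(L/K) →* MulAut N'} {f : N →* N'}

theorem mapDomain_twist (h : ∀ g ν, f (a g ν) = a' g (f ν)) (g : Gal(L/K))
    (w : MonoidAlgebra L N) : MonoidAlgebra.mapDomainAlgHom K L f (twist a g w) =
      twist a' g (MonoidAlgebra.mapDomainAlgHom K L f w) := by
  induction w using MonoidAlgebra.induction_linear with
  | zero => simp
  | add x y hx hy => simp only [map_add, hx, hy]
  | single ν d => simp [h]

theorem map_twistedFixed (hf : Function.Injective f) (h : ∀ g ν, f (a g ν) = a' g (f ν)) :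
    (twistedFixed a).map (MonoidAlgebra.mapDomainAlgHom K L f) =
      (MonoidAlgebra.mapDomainAlgHom K L f).range ⊓ twistedFixed a' := by
  have injective_map : Function.Injective (MonoidAlgebra.mapDomainAlgHom K L f) :=
    MonoidAlgebra.mapDomain_injective hf
  ext w
  constructor
  · rintro ⟨v, hv, rfl⟩
    exact ⟨⟨v, rfl⟩, fun g => (mapDomain_twist h g v).symm.trans (congrArg _ (hv g))⟩
  · rintro ⟨⟨v, rfl⟩, hv⟩
    exact ⟨v, fun g => injective_map ((mapDomain_twist h g v).trans (hv g)), rfl⟩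

theorem nonempty_twistedFixed_algEquiv (e : N ≃* N') (h : ∀ g ν, e (a g ν) = a' g (e ν)) :
    Nonempty (twistedFixed a ≃ₐ[K] twistedFixed a') := by
  let Φ := MonoidAlgebra.mapDomainAlgHom K L e.toMonoidHom
  have range_eq_top : Φ.range = ⊤ :=
    AlgHom.range_eq_top Φ |>.mpr (MonoidAlgebra.domCongr K L e).surjective
  have map_eq : (twistedFixed a).map Φ = twistedFixed a' :=
    (map_twistedFixed e.injective h).trans (by rw [range_eq_top, top_inf_eq])
  have injective_Φ : Function.Injective Φ := MonoidAlgebra.mapDomain_injective e.injective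
  exact ⟨((twistedFixed a).equivMapOfInjective Φ injective_Φ).trans
    (Subalgebra.equivOfEq _ _ map_eq)⟩

variable (K L) in
theorem surjective_mapDomainAlgHom (hf : Function.Surjective f) :
    Function.Surjective (MonoidAlgebra.mapDomainAlgHom K L f) := fun w => by
  induction w using MonoidAlgebra.induction_linear with
  | zero => exact ⟨0, map_zero _⟩
  | add x y hx hy =>
    obtain ⟨v, rfl⟩ := hx
    obtain ⟨w, rfl⟩ := hy
    exact ⟨v + w, map_add ..⟩
  | single ν c =>
    obtain ⟨μ, rfl⟩ := hf ν
    exact ⟨MonoidAlgebra.single μ c, by simp⟩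

variable (K L) in
theorem range_mapDomainAlgHom_subtype_range (f : N →* N') :
    (MonoidAlgebra.mapDomainAlgHom K L f.range.subtype).range =
      (MonoidAlgebra.mapDomainAlgHom K L f).range := by
  have range_comp := congrArg AlgHom.range (MonoidAlgebra.mapDomainAlgHom_comp (R := K) (A := L)
    f.rangeRestrict f.range.subtype)
  rw [f.subtype_comp_rangeRestrict, AlgHom.range_comp,
    (AlgHom.range_eq_top _).mpr (surjective_mapDomainAlgHom K L f.rangeRestrict_surjective),
    Algebra.map_top] at range_comp
  exact range_comp.symm

theorem nonempty_twistedFixed_algEquiv_fixedGroupAlgebra {α : N →* Equiv.Perm Gal(L/K)}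
    (hα : Function.Injective α)
    (h : ∀ g ν, α (a g ν) = leftRegular Gal(L/K) g * α ν * (leftRegular Gal(L/K) g)⁻¹) :
    Nonempty (twistedFixed a ≃ₐ[K] fixedGroupAlgebra K L α.range) := by
  have map_eq : (twistedFixed a).map (MonoidAlgebra.mapDomainAlgHom K L α) =
      fixedGroupAlgebra K L α.range := by
    rw [map_twistedFixed (a' := MulAut.conj.comp (leftRegular Gal(L/K))) hα h, fixedGroupAlgebra,
      range_mapDomainAlgHom_subtype_range]
    congr 1
    ext w
    simp [Algebra.mem_iInf, mem_twistedFixed, galoisConjAction, twist]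
  exact ⟨((twistedFixed a).equivMapOfInjective _ (MonoidAlgebra.mapDomain_injective hα)).trans
    (Subalgebra.equivOfEq _ _ map_eq)⟩

end Equivariant

theorem IsBraceDatum.congr {G N N' : Type*} [Group G] [Group N] [Group N'] {e : G ≃ N}
    {a : G →* MulAut N} (h : IsBraceDatum e a) (f : N ≃* N') :
    IsBraceDatum (e.trans f.toEquiv) ((MulAut.congr f).toMonoidHom.comp a) := fun τ g => by
  simp [h τ g]

theorem mem_zpowers_pow_of_pow_eq_one {A : Type*} [Group A] {θ f : A} {m k : ℕ} (hm : m ≠ 0)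
    (hθ : orderOf θ = m * k) (hmem : f ∈ Subgroup.zpowers θ) (hf : f ^ m = 1) :
    f ∈ Subgroup.zpowers (θ ^ k) := by
  obtain ⟨j, rfl⟩ := hmem
  change (θ ^ j) ^ m = 1 at hf
  rw [← zpow_natCast, ← zpow_mul, ← orderOf_dvd_iff_zpow_eq_one, hθ, mul_comm j, Nat.cast_mul] at hf
  obtain ⟨i, rfl⟩ := Int.dvd_of_mul_dvd_mul_left (Nat.cast_ne_zero.mpr hm) hf
  exact ⟨i, by simp [zpow_mul]⟩

theorem exists_mulAut_apply_eq_pow {N : Type*} [Group N] [IsCyclic N] {x : ℕ}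
    (hx : (Nat.card N).Coprime x) : ∃ f : MulAut N, ∀ ν, f ν = ν ^ x :=
  letI := IsCyclic.commGroup (α := N)
  ⟨{ powCoprime hx with map_mul' := fun _ _ => mul_pow .. }, fun _ => rfl⟩

theorem pow_prime_pow_modEq_one {p x : ℕ} (hx : x ≡ 1 [MOD p]) (n : ℕ) :
    x ^ p ^ n ≡ 1 [MOD p ^ (n + 1)] := by
  have h := dvd_sub_pow_of_dvd_sub (R := ℤ) (by simpa using hx.symm.dvd) n
  rw [one_pow] at h
  exact ((Nat.modEq_iff_dvd).mpr (by exact_mod_cast h)).symm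

namespace CyclicChoice

section

variable {p n : ℕ} {G : Type v} {N : Type w} [Group G] [Group N] (D : CyclicChoice p n G N)

include D in
theorem finite_G : Finite G :=
  Nat.finite_of_card_ne_zero (by rw [D.card_G]; exact (pow_pos D.prime.pos n).ne')

include D in
theorem finite_N : Finite N :=
  Nat.finite_of_card_ne_zero (by rw [D.card_N]; exact (pow_pos D.prime.pos n).ne')

include D in
theorem isCyclic_N : IsCyclic N := ⟨D.η, D.η_gen⟩

theorem mulAut_ext {f g : MulAut N} (h : f D.η = g D.η) : f = g :=
  (MulEquiv.eq_iff_eq_on_generator D.η_gen f g).mpr h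

theorem orderOf_θ : orderOf D.θ = p ^ (n - 1) * (p - 1) := by
  have := D.finite_N
  have := D.isCyclic_N
  rw [orderOf_eq_card_of_forall_mem_zpowers D.θ_gen, IsCyclic.card_mulAut, D.card_N,
    Nat.totient_prime_pow D.prime D.pos]

theorem orderOf_δ : orderOf D.δ = p ^ (n - 1) := by
  have h := Nat.sub_pos_of_lt D.prime.one_lt
  rw [δ, orderOf_pow_of_dvd h.ne' (by rw [D.orderOf_θ]; exact dvd_mul_left _ _), D.orderOf_θ,
    Nat.mul_div_cancel _ h]

theorem orderOf_δ_pow_dvd (s : ℕ) : orderOf (D.δ ^ s) ∣ orderOf D.σ := by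
  refine (orderOf_pow_dvd s).trans ?_
  rw [D.orderOf_δ, D.orderOf_σ]
  exact pow_dvd_pow p (Nat.sub_le n 1)

/-- The action of `G` on `N` by automorphisms for which `σ` acts as `δ ^ s`. -/
noncomputable def action (s : ℕ) : G →* MulAut N :=
  monoidHomOfForallMemZpowers D.σ_gen (D.orderOf_δ_pow_dvd s)

@[simp] theorem action_σ (s : ℕ) : D.action s D.σ = D.δ ^ s :=
  monoidHomOfForallMemZpowers_apply_gen D.σ_gen (D.orderOf_δ_pow_dvd s)

theorem β_apply_mul (s : ℕ) (g : G) (μ κ : N) :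
    D.β s g (μ * κ) = D.action s g μ * D.β s g κ := by
  have := D.finite_G
  obtain ⟨k, rfl⟩ := mem_powers_iff_mem_zpowers.mpr (D.σ_gen g)
  change D.β s (D.σ ^ k) (μ * κ) = D.action s (D.σ ^ k) μ * D.β s (D.σ ^ k) κ
  induction k generalizing μ κ with
  | zero => simp
  | succ k ih =>
    have hσ : D.β s D.σ (μ * κ) = D.action s D.σ μ * D.β s D.σ κ := by
      rw [β_σ, action_σ]
      change (D.δ ^ s) (μ * κ) * D.η⁻¹ = (D.δ ^ s) μ * ((D.δ ^ s) κ * D.η⁻¹)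
      rw [map_mul, mul_assoc]
    rw [pow_succ, map_mul (D.β s), map_mul (D.action s), Equiv.Perm.mul_apply, hσ, ih,
      Equiv.Perm.mul_apply, MulAut.mul_apply]

/-- The bijection `g ↦ b_s(g)⁻¹` from `G` to `N`. The inverse makes it send `σ` to `η`. -/
noncomputable def braceEquiv (s : ℕ) : G ≃ N :=
  (Equiv.ofBijective _ (D.β_bijective s)).trans (Equiv.inv N)

theorem braceEquiv_apply (s : ℕ) (g : G) : D.braceEquiv s g = (D.β s g 1)⁻¹ := rfl

theorem braceEquiv_σ (s : ℕ) : D.braceEquiv s D.σ = D.η := by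
  rw [braceEquiv_apply, β_σ]
  change ((D.δ ^ s) 1 * D.η⁻¹)⁻¹ = D.η
  rw [map_one, one_mul, inv_inv]

theorem isBraceDatum (s : ℕ) : IsBraceDatum (D.braceEquiv s) (D.action s) := fun τ g => by
  simp only [braceEquiv_apply]
  rw [map_mul, Equiv.Perm.mul_apply, ← mul_one (D.β s g 1), β_apply_mul, mul_inv_rev, map_inv,
    mul_one]

theorem injective_α (s : ℕ) : Function.Injective (D.α s) :=
  (Equiv.ofBijective _ (D.β_bijective s)).symm.permCongrHom.injective.comp
    MulAction.toPerm_injective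

theorem α_action (s : ℕ) (g : G) (ν : N) :
    D.α s (D.action s g ν) = leftRegular G g * D.α s ν * (leftRegular G g)⁻¹ := by
  let b := Equiv.ofBijective _ (D.β_bijective s)
  have b_α (μ x) : b (D.α s μ x) = μ * b x := b.apply_symm_apply _
  have b_mul (x) : b (g * x) = D.β s g (b x) := by
    change D.β s (g * x) 1 = D.β s g (D.β s x 1)
    rw [map_mul, Equiv.Perm.mul_apply]
  rw [eq_mul_inv_iff_mul_eq]
  ext x
  apply b.injective
  change b (D.α s (D.action s g ν) (g * x)) = b (g * (D.α s ν x))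
  rw [b_α, b_mul, b_mul, b_α, β_apply_mul]

theorem exists_δ_pow_eq {x : ℕ} (hx : x ≡ 1 [MOD p]) :
    ∃ s < p ^ (n - 1), (D.δ ^ s) D.η = D.η ^ x := by
  have := D.finite_N
  have := D.isCyclic_N
  have coprime : (Nat.card N).Coprime x := by
    rw [D.card_N]
    exact .pow_left n (Nat.coprime_comm.mp (hx.gcd_eq.trans (Nat.gcd_one_left p)))
  obtain ⟨f, hf⟩ := exists_mulAut_apply_eq_pow coprime
  have f_pow_eq_one : f ^ p ^ (n - 1) = 1 := by
    apply D.mulAut_ext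
    rw [mulAut_pow_apply (hf D.η), MulAut.one_apply]
    conv_rhs => rw [← pow_one D.η]
    rw [pow_eq_pow_iff_modEq, D.orderOf_η]
    simpa only [Nat.sub_add_cancel D.pos] using pow_prime_pow_modEq_one hx (n - 1)
  have f_mem : f ∈ Subgroup.zpowers D.δ :=
    mem_zpowers_pow_of_pow_eq_one (pow_pos D.prime.pos _).ne' D.orderOf_θ (D.θ_gen f) f_pow_eq_one
  obtain ⟨s, rfl⟩ := mem_powers_iff_mem_zpowers.mpr f_mem
  refine ⟨s % p ^ (n - 1), Nat.mod_lt _ (pow_pos D.prime.pos _), ?_⟩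
  rw [← D.orderOf_δ, pow_mod_orderOf]
  exact hf D.η

theorem exists_nat_exponent (s : ℕ) : ∃ x : ℕ, (D.δ ^ s) D.η = D.η ^ x := by
  have := D.finite_N
  obtain ⟨x, hx⟩ := mem_powers_iff_mem_zpowers.mpr (D.η_gen ((D.δ ^ s) D.η))
  exact ⟨x, hx.symm⟩

end

section

variable {K : Type u} {L : Type v} [Field K] [Field L] [Algebra K L] {N : Type w} [Group N]
  {p n : ℕ} (D : CyclicChoice p n Gal(L/K) N)

theorem nonempty_twistedFixed_algEquiv_H (s : ℕ) :
    Nonempty (twistedFixed (D.action s) ≃ₐ[K] D.H s) :=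
  nonempty_twistedFixed_algEquiv_fixedGroupAlgebra (D.injective_α s) (D.α_action s)

/-- The isomorphism `N ≃ Gal(L/K)` sending `η` to `σ`. It transports `N` to the universe of `L`, in
which the group of a Hopf-Galois structure has to live. -/
noncomputable def equivGal : N ≃* Gal(L/K) :=
  mulEquivOfOrderOfEq D.η_gen D.σ_gen (D.orderOf_η.trans D.orderOf_σ.symm)

variable [FiniteDimensional K L] [IsGalois K L]

/-- The Hopf-Galois structure on `L/K` with underlying algebra isomorphic to `H_s`. -/
noncomputable def hopfGaloisStructure (s : ℕ) : HopfGaloisStructure K L :=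
  ((D.isBraceDatum s).congr D.equivGal).hopfGaloisStructure

theorem nonempty_hopfGaloisStructure_algEquiv_H (s : ℕ) :
    Nonempty ((D.hopfGaloisStructure s).H ≃ₐ[K] D.H s) := by
  obtain ⟨e⟩ := D.nonempty_twistedFixed_algEquiv_H s
  obtain ⟨f⟩ := nonempty_twistedFixed_algEquiv (K := K) (L := L) (a' := D.action s)
    (a := (MulAut.congr D.equivGal).toMonoidHom.comp (D.action s)) D.equivGal.symm
    fun g ν => by simp
  exact ⟨f.trans e⟩

theorem hasExponent_hopfGaloisStructure {s x : ℕ} (hx : (D.δ ^ s) D.η = D.η ^ x) :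
    (D.hopfGaloisStructure s).HasExponent D.σ x :=
  ((D.isBraceDatum s).congr D.equivGal).hasExponent (by simp [D.braceEquiv_σ, hx])

end

end CyclicChoice

/-! ### Isomorphism classes of the fixed rings as algebras -/

section Perm

variable {X : Type*} {g h : Equiv.Perm X}

theorem sameCycle_iff_of_zpowers_eq (hgh : Subgroup.zpowers g = Subgroup.zpowers h) {x y : X} :
    g.SameCycle x y ↔ h.SameCycle x y := by
  have sameCycle_iff (f : Equiv.Perm X) : f.SameCycle x y ↔ ∃ k ∈ Subgroup.zpowers f, k x = y :=
    ⟨fun ⟨i, hi⟩ => ⟨_, ⟨i, rfl⟩, hi⟩, by rintro ⟨_, ⟨i, rfl⟩, hi⟩; exact ⟨i, hi⟩⟩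
  rw [sameCycle_iff, sameCycle_iff, hgh]

theorem apply_eq_self_of_mem_zpowers (hh : h ∈ Subgroup.zpowers g) {x : X} (hx : g x = x) :
    h x = x := by
  obtain ⟨i, rfl⟩ := hh
  exact Equiv.Perm.zpow_apply_eq_self_of_apply_eq_self hx i

section Fintype

variable [Fintype X] [DecidableEq X]

theorem cycleFactorsFinset_eq_image_cycleOf (g : Equiv.Perm X) :
    g.cycleFactorsFinset = g.support.image g.cycleOf := by
  ext c
  rw [Finset.mem_image]
  constructor
  · intro hc
    obtain ⟨x, hx⟩ := (Equiv.Perm.mem_cycleFactorsFinset_iff.mp hc).1.nonempty_support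
    exact ⟨x, Equiv.Perm.mem_cycleFactorsFinset_support_le hc hx,
      (Equiv.Perm.cycle_is_cycleOf hx hc).symm⟩
  · rintro ⟨x, hx, rfl⟩
    exact Equiv.Perm.cycleOf_mem_cycleFactorsFinset_iff.mpr hx

theorem injOn_support_cycleFactorsFinset (g : Equiv.Perm X) :
    Set.InjOn Equiv.Perm.support (g.cycleFactorsFinset : Set (Equiv.Perm X)) := by
  intro c hc d hd hcd
  obtain ⟨x, hx⟩ := (Equiv.Perm.mem_cycleFactorsFinset_iff.mp hc).1.nonempty_support
  rw [Equiv.Perm.cycle_is_cycleOf hx hc, Equiv.Perm.cycle_is_cycleOf (hcd ▸ hx) hd]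

theorem cycleType_eq_map_card_image (g : Equiv.Perm X) :
    g.cycleType =
      (g.support.image fun x => Finset.univ.filter (g.SameCycle x)).1.map Finset.card := by
  have support_cycleOf {x} (hx : x ∈ g.support) :
      (g.cycleOf x).support = Finset.univ.filter (g.SameCycle x) := by
    ext y
    rw [Equiv.Perm.mem_support_cycleOf_iff, and_iff_left hx, Finset.mem_filter_univ]
  rw [Equiv.Perm.cycleType_def, ← Multiset.map_map,
    ← Finset.image_val_of_injOn (injOn_support_cycleFactorsFinset g),
    cycleFactorsFinset_eq_image_cycleOf, Finset.image_image]
  exact congrArg (fun s => Multiset.map Finset.card s.1)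
    (Finset.image_congr fun x hx => support_cycleOf hx)

end Fintype

theorem isConj_of_zpowers_eq [Finite X] (hgh : Subgroup.zpowers g = Subgroup.zpowers h) :
    IsConj g h := by
  classical
  have := Fintype.ofFinite X
  have support_eq : g.support = h.support := by
    ext x
    rw [Equiv.Perm.mem_support, Equiv.Perm.mem_support]
    exact not_congr
      ⟨apply_eq_self_of_mem_zpowers (hgh ▸ Subgroup.mem_zpowers h),
        apply_eq_self_of_mem_zpowers (hgh ▸ Subgroup.mem_zpowers g)⟩
  rw [Equiv.Perm.isConj_iff_cycleType_eq, cycleType_eq_map_card_image, cycleType_eq_map_card_image,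
    support_eq]
  simp only [sameCycle_iff_of_zpowers_eq hgh]

end Perm

section Characters

variable {K : Type u} {L : Type v} [Field K] [Field L] [Algebra K L] {N : Type w} [Group N]
  (a : Gal(L/K) →* MulAut N)

theorem lift_twist {χ : N →* L} {τ : Gal(L/K)} (hχ : ∀ ν, τ (χ ν) = χ ν) (w : MonoidAlgebra L N) :
    MonoidAlgebra.lift L L N χ (twist a τ w) =
      τ (MonoidAlgebra.lift L L N (χ.comp (a τ).toMonoidHom) w) := by
  induction w using MonoidAlgebra.induction_linear with
  | zero => simp only [map_zero]
  | add v w hv hw => simp only [map_add, hv, hw]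
  | single ν c => simp [hχ]

section Fourier

variable (L) in
/-- A `K`-valued character as an `L`-valued character. -/
def charExtend (χ : N →* Kˣ) : N →* L :=
  ((algebraMap K L : K →+* L) : K →* L).comp ((Units.coeHom K).comp χ)

theorem injective_charExtend : Function.Injective (charExtend L : (N →* Kˣ) → N →* L) := by
  intro χ ψ h
  ext ν
  exact (algebraMap K L).injective (DFunLike.congr_fun h ν)

variable (K L N) in
/-- The Fourier transform on `L[N]` with respect to the `K`-valued characters of `N`. -/
noncomputable def charFourier : MonoidAlgebra L N →ₐ[L] ((N →* Kˣ) → L) :=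
  AlgHom.pi fun χ => MonoidAlgebra.lift L L N (charExtend L χ)

theorem charFourier_apply (w : MonoidAlgebra L N) (χ : N →* Kˣ) :
    charFourier K L N w χ = MonoidAlgebra.lift L L N (charExtend L χ) w := rfl

theorem charFourier_twist (τ : Gal(L/K)) (w : MonoidAlgebra L N) (χ : N →* Kˣ) :
    charFourier K L N (twist a τ w) χ =
      τ (charFourier K L N w (DomMulAct.mk (a τ) • χ)) :=
  lift_twist a (fun ν => τ.commutes (χ ν)) w

theorem mem_twistedFixed_iff_charFourier [FiniteDimensional K L]
    (hF : Function.Injective (charFourier K L N)) {σ : Gal(L/K)}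
    (hσ : ∀ g, g ∈ Subgroup.zpowers σ) {w : MonoidAlgebra L N} :
    w ∈ twistedFixed a ↔
      ∀ χ, σ (charFourier K L N w (DomMulAct.mk (a σ) • χ)) = charFourier K L N w χ := by
  simp_rw [← charFourier_twist, ← funext_iff, hF.eq_iff]
  exact ⟨fun h => h σ, (twistAction a).mem_invariants_of_act_eq hσ⟩

theorem bijective_charFourier [Finite N] (hN : Nat.card (N →* Kˣ) = Nat.card N) :
    Function.Bijective (charFourier K L N) := by
  have : Finite (N →* Kˣ) := Nat.finite_of_card_ne_zero (by rw [hN]; exact Nat.card_pos.ne')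
  have := Fintype.ofFinite N
  have := Fintype.ofFinite (N →* Kˣ)
  have independent : LinearIndependent L fun (χ : N →* Kˣ) (ν : N) => charExtend L χ ν :=
    (linearIndependent_monoidHom N L).comp _ injective_charExtend
  have surjective : Function.Surjective (charFourier K L N).toLinearMap := by
    rw [← LinearMap.range_eq_top, ← top_le_iff,
      ← (span_flip_eq_top_iff_linearIndependent).mpr independent, Submodule.span_le]
    rintro _ ⟨ν, rfl⟩
    exact ⟨MonoidAlgebra.single ν 1, funext fun χ => by simp [charFourier_apply, flip]⟩
  have finrank_eq : Module.finrank L (MonoidAlgebra L N) =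
      Module.finrank L ((N →* Kˣ) → L) := by
    rw [(MonoidAlgebra.coeffLinearEquiv L).finrank_eq, Module.finrank_finsupp_self,
      Module.finrank_fintype_fun_eq_card, ← Nat.card_eq_fintype_card, ← Nat.card_eq_fintype_card,
      hN]
  exact ⟨(LinearMap.injective_iff_surjective_of_finrank_eq_finrank finrank_eq).mpr surjective,
    surjective⟩

theorem exists_algEquiv_charFourier (hF : Function.Bijective (charFourier K L N))
    (θ : Equiv.Perm (N →* Kˣ)) : ∃ Ξ : MonoidAlgebra L N ≃ₐ[L] MonoidAlgebra L N,
      ∀ w χ, charFourier K L N (Ξ w) χ = charFourier K L N w (θ χ) := by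
  let F := AlgEquiv.ofBijective (charFourier K L N) hF
  let reindex := AlgEquiv.piCongrLeft' L (fun _ : N →* Kˣ => L) θ.symm
  exact ⟨(F.trans reindex).trans F.symm, fun w χ =>
    congrFun (F.apply_symm_apply (reindex (F w))) χ⟩

variable {a} {a' : Gal(L/K) →* MulAut N} [FiniteDimensional K L] {σ : Gal(L/K)}

theorem nonempty_twistedFixed_algEquiv_of_semiconj (hF : Function.Bijective (charFourier K L N))
    (hσ : ∀ g, g ∈ Subgroup.zpowers σ) (θ : Equiv.Perm (N →* Kˣ))
    (hθ : ∀ χ, θ (DomMulAct.mk (a σ) • χ) = DomMulAct.mk (a' σ) • θ χ) :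
    Nonempty (twistedFixed a ≃ₐ[K] twistedFixed a') := by
  obtain ⟨Ξ, hΞ⟩ := exists_algEquiv_charFourier hF θ
  have mem_iff (w) : Ξ w ∈ twistedFixed a ↔ w ∈ twistedFixed a' := by
    rw [mem_twistedFixed_iff_charFourier a hF.1 hσ, mem_twistedFixed_iff_charFourier a' hF.1 hσ]
    simp only [hΞ, hθ]
    exact θ.forall_congr_right (q := fun χ =>
      σ (charFourier K L N w (DomMulAct.mk (a' σ) • χ)) = charFourier K L N w χ)
  have map_eq : (twistedFixed a').map (Ξ.toAlgHom.restrictScalars K) = twistedFixed a := by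
    ext w
    obtain ⟨v, rfl⟩ := Ξ.surjective w
    rw [mem_iff, Subalgebra.mem_map]
    exact ⟨fun ⟨u, hu, huv⟩ => Ξ.injective huv ▸ hu, fun hv => ⟨v, hv, rfl⟩⟩
  exact ⟨(((twistedFixed a').equivMapOfInjective _ Ξ.injective).trans
    (Subalgebra.equivOfEq _ _ map_eq)).symm⟩

theorem nonempty_twistedFixed_algEquiv_of_zpowers_eq [Finite N]
    (hN : Nat.card (N →* Kˣ) = Nat.card N) (hσ : ∀ g, g ∈ Subgroup.zpowers σ)
    (h : Subgroup.zpowers (a σ) = Subgroup.zpowers (a' σ)) :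
    Nonempty (twistedFixed a ≃ₐ[K] twistedFixed a') := by
  have : Finite (N →* Kˣ) := Nat.finite_of_card_ne_zero (by rw [hN]; exact Nat.card_pos.ne')
  let perm (b : MulAut N) : Equiv.Perm (N →* Kˣ) := MulAction.toPerm (DomMulAct.mk b)
  have perm_mem {b c : MulAut N} (hbc : b ∈ Subgroup.zpowers c) :
      perm b ∈ Subgroup.zpowers (perm c) := by
    obtain ⟨i, rfl⟩ := hbc
    exact ⟨i, (map_zpow (MulAction.toPermHom (MulAut N)ᵈᵐᵃ (N →* Kˣ)) (DomMulAct.mk c) i).symm⟩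
  obtain ⟨θ, hθ⟩ := isConj_iff.mp <| isConj_of_zpowers_eq <| le_antisymm
    (Subgroup.zpowers_le.mpr (perm_mem (h ▸ Subgroup.mem_zpowers (a σ))))
    (Subgroup.zpowers_le.mpr (perm_mem (h ▸ Subgroup.mem_zpowers (a' σ))))
  exact nonempty_twistedFixed_algEquiv_of_semiconj (bijective_charFourier hN) hσ θ fun χ =>
    DFunLike.congr_fun (mul_inv_eq_iff_eq_mul.mp hθ) χ

end Fourier

variable [FiniteDimensional K L] [IsGalois K L] {a}

theorem exists_algHom_eq_on_twistedFixed (f : twistedFixed a →ₐ[K] L) :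
    ∃ F : MonoidAlgebra L N →ₐ[L] L, ∀ h : twistedFixed a, F h = f h := by
  let μ := AlgEquiv.ofBijective (twistedFixedLift a) (bijective_twistedFixedLift a)
  have μ_symm_coe (h : twistedFixed a) : μ.symm (h : MonoidAlgebra L N) = 1 ⊗ₜ h := by
    rw [AlgEquiv.symm_apply_eq]
    simp [μ]
  exact ⟨(Algebra.TensorProduct.lift (AlgHom.id L L) f fun _ _ => Commute.all _ _).comp
    (μ.symm : MonoidAlgebra L N →ₐ[L] L ⊗[K] twistedFixed a), fun h => by simp [μ_symm_coe]⟩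

theorem algHom_ext_twistedFixed {F F' : MonoidAlgebra L N →ₐ[L] L}
    (h : ∀ k : twistedFixed a, F k = F' k) : F = F' := by
  have comp_eq : F.comp (twistedFixedLift a) = F'.comp (twistedFixedLift a) :=
    Algebra.TensorProduct.ext (Subsingleton.elim _ _) (AlgHom.ext fun k => by simpa using h k)
  exact AlgHom.cancel_right (bijective_twistedFixedLift a).2 |>.mp comp_eq

theorem apply_eq_self_of_act_eq_one {τ : Gal(L/K)} (hτ : ∀ (χ : N →* L) ν, τ (χ ν) = χ ν)
    (ha : a τ = 1) (f : twistedFixed a →ₐ[K] L) (h : twistedFixed a) : τ (f h) = f h := by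
  obtain ⟨F, hF⟩ := exists_algHom_eq_on_twistedFixed f
  obtain ⟨χ, rfl⟩ := (MonoidAlgebra.lift L L N).surjective F
  have := lift_twist a (hτ χ) (h : MonoidAlgebra L N)
  rw [(mem_twistedFixed a).mp h.2, ha] at this
  rw [← hF]
  exact this.symm

theorem act_eq_one_of_forall_apply_eq_self {τ : Gal(L/K)} {χ : N →* L}
    (hχ : Function.Injective χ) (hτ : ∀ ν, τ (χ ν) = χ ν)
    (h : ∀ (f : twistedFixed a →ₐ[K] L) (k : twistedFixed a), τ (f k) = f k) : a τ = 1 := by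
  have lift_eq : MonoidAlgebra.lift L L N χ =
      MonoidAlgebra.lift L L N (χ.comp (a τ).toMonoidHom) :=
    algHom_ext_twistedFixed (a := a) fun k => τ.injective <| by
      rw [← lift_twist a hτ, (mem_twistedFixed a).mp k.2]
      exact h (((MonoidAlgebra.lift L L N χ).restrictScalars K).comp (twistedFixed a).val) k
  ext ν
  exact (hχ (DFunLike.congr_fun ((MonoidAlgebra.lift L L N).injective lift_eq) ν)).symm

theorem act_eq_one_of_algEquiv {a' : Gal(L/K) →* MulAut N} {τ : Gal(L/K)}
    (hτ : ∀ (χ : N →* L) ν, τ (χ ν) = χ ν) {χ : N →* L} (hχ : Function.Injective χ)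
    (e : twistedFixed a ≃ₐ[K] twistedFixed a') (ha : a τ = 1) : a' τ = 1 :=
  act_eq_one_of_forall_apply_eq_self hχ (hτ χ) fun f k => by
    simpa using apply_eq_self_of_act_eq_one hτ ha
      (f.comp (e : twistedFixed a →ₐ[K] twistedFixed a')) (e.symm k)

end Characters

theorem zpowers_pow_gcd_orderOf {A : Type*} [Group A] (x : A) (r : ℕ) :
    Subgroup.zpowers (x ^ (orderOf x).gcd r) = Subgroup.zpowers (x ^ r) := by
  apply le_antisymm <;> rw [Subgroup.zpowers_le]
  · refine ⟨(orderOf x).gcdB r, ?_⟩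
    change (x ^ r) ^ (orderOf x).gcdB r = _
    rw [← zpow_natCast x (Nat.gcd _ _), Nat.gcd_eq_gcd_ab, zpow_add, zpow_mul, zpow_mul,
      zpow_natCast, zpow_natCast, pow_orderOf_eq_one, one_zpow, one_mul]
  · obtain ⟨c, hc⟩ := (orderOf x).gcd_dvd_right r
    have pow_eq : x ^ r = (x ^ (orderOf x).gcd r) ^ c := by rw [← pow_mul, ← hc]
    exact pow_eq ▸ Subgroup.pow_mem _ (Subgroup.mem_zpowers _) c

theorem gcd_orderOf_eq_of_orderOf_pow_eq {A : Type*} [Group A] {x : A} (hx : IsOfFinOrder x)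
    {r s : ℕ} (h : orderOf (x ^ r) = orderOf (x ^ s)) :
    (orderOf x).gcd r = (orderOf x).gcd s := by
  have gcd_eq (r : ℕ) : (orderOf x).gcd r = orderOf x / orderOf (x ^ r) := by
    rw [hx.orderOf_pow, Nat.div_div_self (Nat.gcd_dvd_left _ r) hx.orderOf_pos.ne']
  rw [gcd_eq, gcd_eq, h]

namespace CyclicChoice

variable {K : Type u} {L : Type v} [Field K] [Field L] [Algebra K L] {N : Type w} [Group N]
  {p n : ℕ} (D : CyclicChoice p n Gal(L/K) N)

include D

theorem card_characters (hζ : ∃ ζ : K, IsPrimitiveRoot ζ (p ^ n)) :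
    Nat.card (N →* Kˣ) = Nat.card N := by
  have := D.finite_N
  have := D.isCyclic_N
  have : NeZero (Nat.card N) := ⟨Nat.card_pos.ne'⟩
  have : HasEnoughRootsOfUnity K (Nat.card N) := ⟨by rwa [D.card_N], inferInstance⟩
  let := IsCyclic.commGroup (α := N)
  obtain ⟨e⟩ := IsCyclic.monoidHom_equiv_self N K
  exact Nat.card_congr e.toEquiv

theorem galois_apply_character (hζ : ∃ ζ : K, IsPrimitiveRoot ζ (p ^ n)) (χ : N →* L)
    (τ : Gal(L/K)) (ν : N) : τ (χ ν) = χ ν := by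
  obtain ⟨ζ, hζ⟩ := hζ
  have : NeZero (p ^ n) := ⟨(pow_pos D.prime.pos n).ne'⟩
  have pow_eq_one : χ ν ^ p ^ n = 1 := by rw [← map_pow, ← D.card_N, pow_card_eq_one', map_one]
  obtain ⟨i, -, hi⟩ := (hζ.map_of_injective (algebraMap K L).injective).eq_pow_of_pow_eq_one
    pow_eq_one
  rw [← hi, ← map_pow, AlgEquiv.commutes]

theorem exists_injective_character (hζ : ∃ ζ : K, IsPrimitiveRoot ζ (p ^ n)) :
    ∃ χ : N →* L, Function.Injective χ := by
  obtain ⟨ζ, hζ⟩ := hζ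
  have hζL : IsPrimitiveRoot (algebraMap K L ζ) (p ^ n) :=
    hζ.map_of_injective (algebraMap K L).injective
  let u := (hζL.isUnit (pow_pos D.prime.pos n).ne').unit
  have orderOf_u : orderOf u = orderOf D.η := by
    rw [← orderOf_units, IsUnit.unit_spec, ← hζL.eq_orderOf, D.orderOf_η]
  let χ : N →* Lˣ := monoidHomOfForallMemZpowers D.η_gen orderOf_u.dvd
  refine ⟨(Units.coeHom L).comp χ, Units.val_injective.comp ((injective_iff_map_eq_one χ).mpr ?_)⟩
  intro ν hν
  obtain ⟨k, rfl⟩ := D.η_gen ν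
  rw [map_zpow, monoidHomOfForallMemZpowers_apply_gen] at hν
  exact orderOf_dvd_iff_zpow_eq_one.mp (orderOf_u ▸ orderOf_dvd_iff_zpow_eq_one.mpr hν)

theorem nonempty_algEquiv_H_iff [FiniteDimensional K L] [IsGalois K L]
    (hζ : ∃ ζ : K, IsPrimitiveRoot ζ (p ^ n)) (r s : ℕ) :
    Nonempty (D.H r ≃ₐ[K] D.H s) ↔ (p ^ (n - 1)).gcd r = (p ^ (n - 1)).gcd s := by
  have := D.finite_N
  obtain ⟨er⟩ := D.nonempty_twistedFixed_algEquiv_H r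
  obtain ⟨es⟩ := D.nonempty_twistedFixed_algEquiv_H s
  rw [← D.orderOf_δ]
  constructor
  · rintro ⟨e⟩
    obtain ⟨χ, hχ⟩ := D.exists_injective_character hζ
    have fixed := D.galois_apply_character hζ
    have e' := er.trans (e.trans es.symm)
    have act_eq_one_iff (m : ℕ) :
        D.action r (D.σ ^ m) = 1 ↔ D.action s (D.σ ^ m) = 1 :=
      ⟨act_eq_one_of_algEquiv (fixed · _) hχ e', act_eq_one_of_algEquiv (fixed · _) hχ e'.symm⟩
    simp only [map_pow, action_σ] at act_eq_one_iff
    exact gcd_orderOf_eq_of_orderOf_pow_eq (isOfFinOrder_of_finite D.δ)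
      (orderOf_eq_orderOf_iff.mpr act_eq_one_iff)
  · intro h
    have zpowers_eq : Subgroup.zpowers (D.action r D.σ) = Subgroup.zpowers (D.action s D.σ) := by
      rw [action_σ, action_σ, ← zpowers_pow_gcd_orderOf, h, zpowers_pow_gcd_orderOf]
    obtain ⟨e⟩ := nonempty_twistedFixed_algEquiv_of_zpowers_eq
      (D.card_characters hζ) D.σ_gen zpowers_eq
    exact ⟨er.symm.trans (e.trans es)⟩

end CyclicChoice

/-! ### Counting -/

theorem pow_dvd_of_gcd_pow_eq {p m r s : ℕ} (hr : r < p ^ m) (hs : s < p ^ m)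
    (h : (p ^ m).gcd r = (p ^ m).gcd s) {k : ℕ} (hk : p ^ k ∣ r) : p ^ k ∣ s := by
  rcases le_total k m with hkm | hmk
  · exact (Nat.dvd_gcd (pow_dvd_pow p hkm) hk).trans (h ▸ Nat.gcd_dvd_right _ _)
  · rw [Nat.eq_zero_of_dvd_of_lt ((pow_dvd_pow p hmk).trans hk) hr, Nat.gcd_zero_right] at h
    exact Nat.eq_zero_of_dvd_of_lt (h ▸ Nat.gcd_dvd_right _ _) hs ▸ dvd_zero _

theorem gcd_prime_pow_dvd {p m r s : ℕ} (hp : p.Prime) (h : ∀ k, p ^ k ∣ r → p ^ k ∣ s) :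
    (p ^ m).gcd r ∣ s := by
  obtain ⟨k, -, hk⟩ := (Nat.dvd_prime_pow hp).mp (Nat.gcd_dvd_left (p ^ m) r)
  exact hk ▸ h k (hk ▸ Nat.gcd_dvd_right _ _)

theorem gcd_prime_pow_eq_iff {p m r s : ℕ} (hp : p.Prime) (hr : r < p ^ m) (hs : s < p ^ m) :
    (p ^ m).gcd r = (p ^ m).gcd s ↔ emultiplicity p r = emultiplicity p s := by
  rw [emultiplicity_eq_emultiplicity_iff]
  exact ⟨fun h k => ⟨pow_dvd_of_gcd_pow_eq hr hs h, pow_dvd_of_gcd_pow_eq hs hr h.symm⟩,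
    fun h => Nat.dvd_antisymm
      (Nat.dvd_gcd (Nat.gcd_dvd_left _ _) (gcd_prime_pow_dvd hp fun k => (h k).mp))
      (Nat.dvd_gcd (Nat.gcd_dvd_left _ _) (gcd_prime_pow_dvd hp fun k => (h k).mpr))⟩

theorem HopfGaloisStructure.algSetoid_of_isoSetoid {K : Type u} {L : Type v} [Field K] [Field L]
    [Algebra K L] {S T : HopfGaloisStructure K L} (h : isoSetoid K L S T) :
    algSetoid K L S T := by
  obtain ⟨φ, -⟩ := h
  exact ⟨(φ : S.H ≃ₐ[K] T.H)⟩

namespace CyclicChoice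

open HopfGaloisStructure

variable {K : Type u} {L : Type v} [Field K] [Field L] [Algebra K L] {N : Type w} [Group N]
  {p n : ℕ} (D : CyclicChoice p n Gal(L/K) N) [FiniteDimensional K L] [IsGalois K L]

theorem exists_isoSetoid_hopfGaloisStructure (S : HopfGaloisStructure K L) :
    ∃ s < p ^ (n - 1), isoSetoid K L S (D.hopfGaloisStructure s) := by
  have : Fact p.Prime := ⟨D.prime⟩
  have : Nontrivial Gal(L/K) := Finite.one_lt_card_iff_nontrivial.mp <| by
    rw [D.card_G]
    exact Nat.one_lt_pow D.pos.ne' D.prime.one_lt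
  have isPGroup : IsPGroup p Gal(L/K) := IsPGroup.of_card D.card_G
  obtain ⟨x, x_modEq, hS⟩ := S.isBraceDatum.exists_exponent D.odd isPGroup D.σ_gen
  obtain ⟨s, hs, δ_pow_eq⟩ := D.exists_δ_pow_eq x_modEq
  exact ⟨s, hs, isoSetoid_of_hasExponent D.odd isPGroup D.σ_gen hS
    (D.hasExponent_hopfGaloisStructure δ_pow_eq)⟩

theorem eq_of_isoSetoid_hopfGaloisStructure {r s : ℕ} (hr : r < p ^ (n - 1))
    (hs : s < p ^ (n - 1))
    (h : isoSetoid K L (D.hopfGaloisStructure r) (D.hopfGaloisStructure s)) : r = s := by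
  have : Fact p.Prime := ⟨D.prime⟩
  obtain ⟨x, hx⟩ := D.exists_nat_exponent r
  obtain ⟨y, hy⟩ := D.exists_nat_exponent s
  have x_modEq_y : x ≡ y [MOD orderOf D.η] := by
    rw [D.orderOf_η, ← D.card_G]
    exact (HasExponent.iff_modEq D.odd (IsPGroup.of_card D.card_G) D.σ_gen
      ((D.hasExponent_hopfGaloisStructure hx).congr h)).mp (D.hasExponent_hopfGaloisStructure hy)
  refine pow_injOn_Iio_orderOf (D.orderOf_δ.symm ▸ hr) (D.orderOf_δ.symm ▸ hs) (D.mulAut_ext ?_)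
  exact hx.trans ((pow_eq_pow_iff_modEq.mpr x_modEq_y).trans hy.symm)

variable (hζ : ∃ ζ : K, IsPrimitiveRoot ζ (p ^ n))

include hζ

theorem algSetoid_hopfGaloisStructure_iff (r s : ℕ) :
    algSetoid K L (D.hopfGaloisStructure r) (D.hopfGaloisStructure s) ↔
      (p ^ (n - 1)).gcd r = (p ^ (n - 1)).gcd s := by
  obtain ⟨er⟩ := D.nonempty_hopfGaloisStructure_algEquiv_H r
  obtain ⟨es⟩ := D.nonempty_hopfGaloisStructure_algEquiv_H s
  rw [← D.nonempty_algEquiv_H_iff hζ]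
  exact ⟨fun ⟨e⟩ => ⟨er.symm.trans (e.trans es)⟩, fun ⟨e⟩ => ⟨er.trans (e.trans es.symm)⟩⟩

include D in
theorem natCard_quotient_algSetoid : Nat.card (Quotient (algSetoid K L)) = n := by
  have := D.pos
  let class_of (v : Fin n) : Quotient (algSetoid K L) := ⟦D.hopfGaloisStructure (p ^ (v : ℕ))⟧
  suffices Function.Bijective class_of by
    rw [← Nat.card_congr (Equiv.ofBijective class_of this), Nat.card_fin]
  have gcd_eq {v : ℕ} (hv : v ≤ n - 1) : (p ^ (n - 1)).gcd (p ^ v) = p ^ v :=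
    Nat.gcd_eq_right (pow_dvd_pow p hv)
  constructor
  · intro v w h
    have gcd_eq_gcd := (D.algSetoid_hopfGaloisStructure_iff hζ _ _).mp (Quotient.exact h)
    rw [gcd_eq (by omega), gcd_eq (by omega)] at gcd_eq_gcd
    exact Fin.ext (Nat.pow_right_injective D.prime.two_le gcd_eq_gcd)
  · refine Quotient.ind fun S => ?_
    obtain ⟨s, -, hSs⟩ := D.exists_isoSetoid_hopfGaloisStructure S
    obtain ⟨v, hv, hvs⟩ := (Nat.dvd_prime_pow D.prime).mp (Nat.gcd_dvd_left (p ^ (n - 1)) s)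
    refine ⟨⟨v, by omega⟩, Quotient.sound ?_⟩
    exact (algSetoid K L).trans ((D.algSetoid_hopfGaloisStructure_iff hζ _ _).mpr
      ((gcd_eq hv).trans hvs.symm)) ((algSetoid K L).symm (algSetoid_of_isoSetoid hSs))

theorem natCard_isoSetoid_algEquiv_H {v : ℕ} (hv : v ≤ n - 1) :
    Nat.card {c : Quotient (isoSetoid K L) // ∃ S : HopfGaloisStructure K L,
      Quotient.mk (isoSetoid K L) S = c ∧ Nonempty (S.H ≃ₐ[K] D.H (p ^ v))} =
        (p ^ (n - 1 - v)).totient := by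
  have algEquiv_iff (s : ℕ) : Nonempty ((D.hopfGaloisStructure s).H ≃ₐ[K] D.H (p ^ v)) ↔
      (p ^ (n - 1)).gcd s = p ^ v := by
    obtain ⟨e⟩ := D.nonempty_hopfGaloisStructure_algEquiv_H (p ^ v)
    rw [← Nat.gcd_eq_right (pow_dvd_pow p hv), ← D.algSetoid_hopfGaloisStructure_iff hζ,
      Nat.gcd_eq_right (pow_dvd_pow p hv)]
    exact ⟨fun ⟨f⟩ => ⟨f.trans e.symm⟩, fun ⟨f⟩ => ⟨f.trans e⟩⟩
  rw [← Nat.pow_div hv D.prime.pos, Nat.totient_div_of_dvd (pow_dvd_pow p hv),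
    ← Nat.card_eq_finsetCard]
  symm
  refine Nat.card_eq_of_bijective (fun s => ⟨Quotient.mk _ (D.hopfGaloisStructure s), _, rfl,
    (algEquiv_iff s).mpr (Finset.mem_filter.mp s.2).2⟩) ⟨?_, ?_⟩
  · rintro ⟨r, hr⟩ ⟨s, hs⟩ h
    rw [Finset.mem_filter, Finset.mem_range] at hr hs
    exact Subtype.ext (D.eq_of_isoSetoid_hopfGaloisStructure hr.1 hs.1
      (Quotient.exact (congrArg Subtype.val h)))
  · rintro ⟨c, S, rfl, ⟨e⟩⟩
    obtain ⟨s, hs, hSs⟩ := D.exists_isoSetoid_hopfGaloisStructure S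
    obtain ⟨f⟩ := algSetoid_of_isoSetoid hSs
    exact ⟨⟨s, Finset.mem_filter.mpr ⟨Finset.mem_range.mpr hs,
      (algEquiv_iff s).mp ⟨f.symm.trans e⟩⟩⟩,
      Subtype.ext (Quotient.sound ((isoSetoid K L).symm hSs))⟩

end CyclicChoice

theorem mainTheorem9_general {K : Type u} {L : Type v} {N : Type w} [Field K] [Field L]
    [Algebra K L] [FiniteDimensional K L] [IsGalois K L] [Group N] (p n : ℕ)
    (hζ : ∃ ζ : K, IsPrimitiveRoot ζ (p ^ n)) (D : CyclicChoice p n Gal(L/K) N) :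
    (∀ r s : ℕ, r < p ^ (n - 1) → s < p ^ (n - 1) →
      (Nonempty (D.H r ≃ₐ[K] D.H s) ↔ emultiplicity p r = emultiplicity p s)) ∧
    Nat.card (Quotient (HopfGaloisStructure.algSetoid K L)) = n ∧
    ∀ v : ℕ, v ≤ n - 1 →
      Nat.card {c : Quotient (HopfGaloisStructure.isoSetoid K L) //
        ∃ S : HopfGaloisStructure K L,
          Quotient.mk (HopfGaloisStructure.isoSetoid K L) S = c ∧
            Nonempty (S.H ≃ₐ[K] D.H (p ^ v))} = (p ^ (n - 1 - v)).totient :=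
  ⟨fun r s hr hs =>
      (D.nonempty_algEquiv_H_iff hζ r s).trans (gcd_prime_pow_eq_iff D.prime hr hs),
    D.natCard_quotient_algSetoid hζ, fun _ hv => D.natCard_isoSetoid_algEquiv_H hζ hv⟩

theorem mainTheorem9 {K : Type u} {L : Type v} {N : Type w} [Field K] [CharZero K] [Field L]
    [Algebra K L] [FiniteDimensional K L] [IsGalois K L] [Group N] (p n : ℕ)
    (hζ : ∃ ζ : K, IsPrimitiveRoot ζ (p ^ n)) (D : CyclicChoice p n Gal(L/K) N) :
    (∀ r s : ℕ, r < p ^ (n - 1) → s < p ^ (n - 1) →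
      (Nonempty (D.H r ≃ₐ[K] D.H s) ↔ emultiplicity p r = emultiplicity p s)) ∧
    Nat.card (Quotient (HopfGaloisStructure.algSetoid K L)) = n ∧
    ∀ v : ℕ, v ≤ n - 1 →
      Nat.card {c : Quotient (HopfGaloisStructure.isoSetoid K L) //
        ∃ S : HopfGaloisStructure K L,
          Quotient.mk (HopfGaloisStructure.isoSetoid K L) S = c ∧
            Nonempty (S.H ≃ₐ[K] D.H (p ^ v))} = (p ^ (n - 1 - v)).totient :=
  mainTheorem9_general p n hζ D
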